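/- **Setting.** Let $\Gamma=(V,E)$ be a finite directed graph, $Q$ a finite non-empty set of queries, $m=m_1+m_2\ge 1$. For each query $q$ let node weights $F_q(\varphi_1,i)$, $\varphi_1\in\mathbb R^{m_1}$, $i\in V$, and edge weights $G_q(\varphi_2,\tilde i\to i)$, $\varphi_2\in\mathbb R^{m_2}$, be given, measurable in the parameters, and write $\varphi=(\varphi_1,\varphi_2)\in\mathbb R^m$ (Euclidean norm). Let $V_q$ be the set of vertices $i$ such that, for some $\varphi$, there is a path (possibly of length $0$) in $\Gamma$ from some $i_0$ with $F_q(\varphi_1,i_0)\ne0$ to $i$ along which all $G_q(\varphi_2,\cdot)$ are non-zero; let $E_q$ be the set of edges between vertices of $V_q$ with $G_q(\varphi_2,\cdot)\neq 0$ for some $\varphi_2$; let $p_q=|V_q|$. Put $$[\pi^0_q(\varphi)]_i=\frac{F_q(\varphi_1,i)}{\sum_{j} F_q(\varphi_1,j)},\qquad [P_q(\varphi)]_{\tilde i,i}=\frac{G_q(\varphi_2,\tilde i\to i)}{\sum_{j:\,\tilde i\to j\in E_q} G_q(\varphi_2,\tilde i\to j)},$$ for seed vertices $i$ (those with $F_q(\cdot,i)\not\equiv0$;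 the first sum is over them) and for $\tilde i\to i\in E_q$ respectively, and $0$ otherwise (also $0/0=0$). For a damping factor $\alpha\in(0,1)$ let $\pi_q(\varphi)=\alpha[I-(1-\alpha)P_q^T(\varphi)]^{-1}\pi^0_q(\varphi)$ be the stationary distribution of the random walk, and let $$\tilde\pi_q^N(\varphi)=\frac{\alpha}{1-(1-\alpha)^{N+1}}\sum_{i=0}^N(1-\alpha)^i[P_q^T(\varphi)]^i\pi_q^0(\varphi).$$ For each $q$ some vertices are judged, each with one label in $\{1,\dots,k\}$; $V_q^j$ is the set of vertices of $V_q$ with label $k+1-j$. Let $b_{j_1j_2}>0$ for $1\le j_2<j_1\le k$ and $h(j_1,j_2,x)=(\min\{x+b_{j_1j_2},0\})^2$. The loss is $$f(\varphi)=\frac1{|Q|}\sum_{q\in Q}\ \sum_{1\le j_2<j_1\le k}\ \sum_{i_1\in V_q^{j_1},\,i_2\in V_q^{j_2}}h\big(j_1,j_2,[\pi_q(\varphi)]_{i_2}-[\pi_q(\varphi)]_{i_1}\big),$$ and $f^\delta(\varphi)$ denotes the same expression with $\tilde\pi^N_q(\varphi)$ in place of $\pi_q(\varphi)$. Let $p=\max_qp_q$,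 $r=\max_q r_q$ and $b=\max_q\|b_q\|_2$, where $r_q$ is the number of summands for $q$ and $b_q\in\mathbb R^{r_q}$ is the vector of their margins $b_{j_1j_2}$. **Method.** Given $\varphi_0\in\mathbb R^m$ and $L,R,\varepsilon>0$, put $X=\{\varphi:\|\varphi-\varphi_0\|_2\le2R\}$, $$\delta=\frac{\varepsilon^{3/2}\sqrt2}{32mR\sqrt{L(m+8)}},\quad \mu=\sqrt{\frac{2\varepsilon}{L(m+8)}},\quad M=\Big\lfloor\frac{32mLR^2}{\varepsilon}\Big\rfloor,\quad N=\Big\lfloor\frac1\alpha\ln\frac{2\sqrt{2r}\,(2\sqrt{2r}+2b)}{\delta}\Big\rfloor$$ ($N=0$ if this is negative or $r=0$), and for $n=0,1,\dots,M-1$ $$\varphi_{n+1}=\Pi_X\Big(\varphi_n-\frac1{8mL}\cdot\frac m\mu\big(f^\delta(\varphi_n+\mu s_n)-f^\delta(\varphi_n)\big)s_n\Big),$$ where $\Pi_X$ is the Euclidean projection and $s_0,s_1,\dots$ are independent and uniformly distributed over the unit Euclidean sphere of $\mathbb R^m$. The output $\hat\varphi_M$ is a point of $\{\varphi_0,\dots,\varphi_M\}$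 at which $f$ is smallest. Each of the vectors $\tilde\pi^N_q(\varphi_n)$, $\tilde\pi^N_q(\varphi_n+\mu s_n)$ is computed by $N$ successive multiplications of a vector by $P_q^T$. The arithmetic operations counted are those of these matrix–vector products, the dominant part of the work: one operation (a multiplication with the addition of the product to a running sum) per non-zero entry of $P_q$. **Theorem 2.** Let $\varphi^*$ be a local minimum point of $f$ with $\|\varphi_0-\varphi^*\|_2\le R$, and let $U$ be an open vicinity of $\varphi^*$ that contains the closed ball of radius $3R+\mu$ about $\varphi^*$ (hence all points at which the method can evaluate the objective). Assume that on $U$ the weights $F_q,G_q$ are non-negative, that $f$ is convex on $U$, and that $f$ is differentiable on $U$ with $|f(x)-f(y)-\langle\nabla f(y),x-y\rangle|\le\frac L2\|x-y\|_2^2$ for all $x,y\in U$. Let $s$ bound the number of non-zero entries of every column of $P_q(\varphi)$, for all $q\in Q$ and $\varphi\in U$. Then $$\mathbb E f(\hat\varphi_M)-f(\varphi^*)\le\varepsilon,$$ and the expected total number of arithmetic operations performed to compute $\varphi_0,\dots,\varphi_M$ is at most $$64\,m\,p\,s\,|Q|\,\frac{LR^2}{\alpha\varepsilon}\,\ln\Big(4(2r+b\sqrt{2r})\,\frac{32mR\sqrt{L(m+8)}}{\varepsilon^{3/2}\sqrt2}\Big),$$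 where the logarithm is replaced by $0$ if it is negative or $r=0$. -/

import Mathlib

open MeasureTheory ProbabilityTheory

noncomputable section

/-- The parameter space `ℝ^m`, `m = m₁ + m₂`, with the Euclidean norm; a point is
`φ = (φ₁, φ₂)` with `φ₁ ∈ ℝ^{m₁}`, `φ₂ ∈ ℝ^{m₂}`. -/
abbrev ParamSpace (m₁ m₂ : ℕ) : Type := EuclideanSpace ℝ (Fin m₁ ⊕ Fin m₂)

/-- The node part `φ₁` of a parameter vector. -/
def ParamSpace.node {m₁ m₂ : ℕ} (φ : ParamSpace m₁ m₂) : Fin m₁ → ℝ := fun i => φ (Sum.inl i)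

/-- The edge part `φ₂` of a parameter vector. -/
def ParamSpace.edge {m₁ m₂ : ℕ} (φ : ParamSpace m₁ m₂) : Fin m₂ → ℝ := fun i => φ (Sum.inr i)

/-- The result of a computation together with the number of arithmetic operations it performed.
The unit of cost is the multiplication of a vector entry by a nonzero matrix entry, including
the addition of the product to a running sum (see `SupervisedPageRank.matVec`). -/
structure Counted (β : Type*) where
  val : β
  ops : ℕ

/-- Data of the supervised PageRank learning problem: a directed graph on the vertex set `V`,
node weights `F q φ₁ i` and edge weights `G q φ₂ i j` (used on edges `i → j` only) for every
query `q`, relevance labels of the judged vertices (the labels `1, …, k` are the elements of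
`Fin k`; `none` means that the vertex is not judged), margins `b_{j₁ j₂} > 0` for `j₂ < j₁`,
and the damping factor `α ∈ (0, 1)`. -/
structure SupervisedPageRank (V Q : Type*) (m₁ m₂ k : ℕ) where
  graph : Digraph V
  F : Q → (Fin m₁ → ℝ) → V → ℝ
  G : Q → (Fin m₂ → ℝ) → V → V → ℝ
  label : Q → V → Option (Fin k)
  margin : Fin k → Fin k → ℝ
  margin_pos : ∀ j₁ j₂, j₂ < j₁ → 0 < margin j₁ j₂
  α : ℝ
  α_pos : 0 < α
  α_lt_one : α < 1

namespace SupervisedPageRank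

variable {V Q : Type*} {m₁ m₂ k : ℕ} (D : SupervisedPageRank V Q m₁ m₂ k)

/-! ### The graph of a query -/

/-- The vertices relevant to `q`: those with `F q φ₁ i ≠ 0` for some `φ₁`, and those reached
from an `i₀` with `F q φ₁ i₀ ≠ 0` by a path of edges with `G q φ₂ ≠ 0`, for some `(φ₁, φ₂)`. -/
def relevant (q : Q) : Set V :=
  {i | ∃ (φ₁ : Fin m₁ → ℝ) (φ₂ : Fin m₂ → ℝ) (i₀ : V), D.F q φ₁ i₀ ≠ 0 ∧
    Relation.ReflTransGen (fun u v => D.graph.Adj u v ∧ D.G q φ₂ u v ≠ 0) i₀ i}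

/-- The vertex set `V_q` of the graph of the query `q`. -/
def Vert (q : Q) : Type _ := {i : V // i ∈ D.relevant q}

instance instFintypeVert [Finite V] (q : Q) : Fintype (D.Vert q) :=
  haveI : Finite (D.Vert q) := Subtype.finite
  Fintype.ofFinite _

instance instDecidableEqVert (q : Q) : DecidableEq (D.Vert q) := Classical.decEq _

/-- The edges of the graph of `q`. -/
def IsEdge (q : Q) (u v : D.Vert q) : Prop :=
  D.graph.Adj u.1 v.1 ∧ ∃ φ₂ : Fin m₂ → ℝ, D.G q φ₂ u.1 v.1 ≠ 0

/-- The seed set of `q`. -/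
def IsSeed (q : Q) (i : D.Vert q) : Prop := ∃ φ₁ : Fin m₁ → ℝ, D.F q φ₁ i.1 ≠ 0

variable [Finite V]

/-! ### The random walk -/

open Classical in
/-- The restart probabilities `π⁰_q(φ)`. -/
def restart (q : Q) (φ : ParamSpace m₁ m₂) (i : D.Vert q) : ℝ :=
  if D.IsSeed q i then
    D.F q φ.node i.1 / ∑ j : D.Vert q with D.IsSeed q j, D.F q φ.node j.1
  else 0

open Classical in
/-- The matrix `P_q(φ)` of transition probabilities. -/
def transition (q : Q) (φ : ParamSpace m₁ m₂) : Matrix (D.Vert q) (D.Vert q) ℝ :=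
  Matrix.of fun u v =>
    if D.IsEdge q u v then
      D.G q φ.edge u.1 v.1 / ∑ w : D.Vert q with D.IsEdge q u w, D.G q φ.edge u.1 w.1
    else 0

/-- The stationary distribution `π_q(φ) = α [I - (1 - α) P_q(φ)ᵀ]⁻¹ π⁰_q(φ)`
(see `eq_pageRank_iff`). -/
def pageRank (q : Q) (φ : ParamSpace m₁ m₂) : D.Vert q → ℝ :=
  D.α • ((1 - (1 - D.α) • (D.transition q φ).transpose)⁻¹.mulVec (D.restart q φ))

open Classical in
/-- The largest number of nonzero entries in a column of `P_q(φ)`. -/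
def sparsity (q : Q) (φ : ParamSpace m₁ m₂) : ℕ :=
  Finset.univ.sup fun i : D.Vert q =>
    (Finset.univ.filter fun u : D.Vert q => D.transition q φ u i ≠ 0).card

/-! ### The loss function -/

/-- `V_q^j`: the vertices of `V_q` annotated with the label `k + 1 - j`. -/
def Judged (q : Q) (j : Fin k) (i : D.Vert q) : Prop := D.label q i.1 = some j.rev

open Classical in
/-- The index set of the summands for `q`: all `(j₁, j₂, i₁, i₂)` with `j₂ < j₁`,
`i₁ ∈ V_q^{j₁}` and `i₂ ∈ V_q^{j₂}`. -/
def pairs (q : Q) : Finset (Fin k × Fin k × D.Vert q × D.Vert q) :=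
  Finset.univ.filter fun t => t.2.1 < t.1 ∧ D.Judged q t.1 t.2.2.1 ∧ D.Judged q t.2.1 t.2.2.2

/-- The square loss with margins, `h(j₁, j₂, x) = (min {x + b_{j₁ j₂}, 0})²`. -/
def h (j₁ j₂ : Fin k) (x : ℝ) : ℝ := (min (x + D.margin j₁ j₂) 0) ^ 2

variable [Fintype Q]

/-- The discrepancy between ranking scores `x_q ∈ ℝ^{V_q}` and the judgements. -/
def discrepancy (x : ∀ q, D.Vert q → ℝ) : ℝ :=
  1 / (Fintype.card Q : ℝ) *
    ∑ q, ∑ t ∈ D.pairs q, D.h t.1 t.2.1 (x q t.2.2.2 - x q t.2.2.1)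

/-- The objective function `f`. -/
def loss (φ : ParamSpace m₁ m₂) : ℝ := D.discrepancy fun q => D.pageRank q φ

/-- `p = max_q p_q`, where `p_q` is the number of vertices of the graph of `q`. -/
def p : ℕ := Finset.univ.sup fun q => Fintype.card (D.Vert q)

/-- `r = max_q r_q`, where `r_q` is the number of summands for `q`. -/
def r : ℕ := Finset.univ.sup fun q => (D.pairs q).card

/-- The Euclidean norm of the vector `b_q` of the margins of all the summands for `q`. -/
def marginNorm (q : Q) : ℝ := √(∑ t ∈ D.pairs q, D.margin t.1 t.2.1 ^ 2)

/-- `b = max_q ‖b_q‖₂`. -/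
def b : ℝ := ⨆ q, D.marginNorm q

/-! ### The lower level: approximation of the stationary distribution -/

open Classical in
/-- The product `P_q(φ)ᵀ y`, with one operation for each nonzero entry of `P_q(φ)`. -/
def matVec (q : Q) (φ : ParamSpace m₁ m₂) (y : D.Vert q → ℝ) : Counted (D.Vert q → ℝ) where
  val i := ∑ u : D.Vert q with D.transition q φ u i ≠ 0, D.transition q φ u i * y u
  ops := ∑ i : D.Vert q,
    (Finset.univ.filter fun u : D.Vert q => D.transition q φ u i ≠ 0).card

/-- State of the simple iteration after `n` steps: the vector `(Pᵀ)ⁿ π⁰`, the partial sum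
`∑_{i ≤ n} (1 - α)^i (Pᵀ)^i π⁰`, and the number of operations performed. -/
structure InnerState (q : Q) where
  power : D.Vert q → ℝ
  total : D.Vert q → ℝ
  ops : ℕ

/-- The simple iteration. -/
def innerLoop (q : Q) (φ : ParamSpace m₁ m₂) : ℕ → D.InnerState q
  | 0 => ⟨D.restart q φ, D.restart q φ, 0⟩
  | n + 1 =>
    let st := innerLoop q φ n
    let y := D.matVec q φ st.power
    ⟨y.val, st.total + (1 - D.α) ^ (n + 1) • y.val, st.ops + y.ops⟩

/-- The approximation of `π_q(φ)` by `N` steps of the simple iteration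
(see `approxRank_val`). -/
def approxRank (N : ℕ) (q : Q) (φ : ParamSpace m₁ m₂) : Counted (D.Vert q → ℝ) where
  val := (D.α / (1 - (1 - D.α) ^ (N + 1))) • (D.innerLoop q φ N).total
  ops := (D.innerLoop q φ N).ops

/-- The inexact value `f^δ(φ)` of the objective. -/
def approxLoss (N : ℕ) (φ : ParamSpace m₁ m₂) : Counted ℝ where
  val := D.discrepancy fun q => (D.approxRank N q φ).val
  ops := ∑ q, (D.approxRank N q φ).ops

end SupervisedPageRank

/-! ### The upper level: random gradient-free method -/

/-- Euclidean projection onto the closed ball of centre `c` and radius `ρ`. -/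
def projBall {m₁ m₂ : ℕ} (c : ParamSpace m₁ m₂) (ρ : ℝ) (x : ParamSpace m₁ m₂) :
    ParamSpace m₁ m₂ :=
  if ‖x - c‖ ≤ ρ then x else c + (ρ / ‖x - c‖) • (x - c)

/-- The uniform distribution on the unit Euclidean sphere of `ℝ^m`: the normalised surface
measure, as a measure on `ℝ^m`. -/
def uniformSphere (m₁ m₂ : ℕ) : Measure (ParamSpace m₁ m₂) :=
  (((volume : Measure (ParamSpace m₁ m₂)).toSphere Set.univ)⁻¹ •
    (volume : Measure (ParamSpace m₁ m₂)).toSphere).map Subtype.val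

/-- The smoothing parameter `μ = √(2ε / (L (m + 8)))`. -/
def smoothing (m : ℕ) (L ε : ℝ) : ℝ := √(2 * ε / (L * (m + 8)))

/-- The oracle accuracy `δ = ε^{3/2} √2 / (32 m R √(L (m + 8)))`. -/
def oracleAcc (m : ℕ) (L R ε : ℝ) : ℝ :=
  ε ^ (3 / 2 : ℝ) * √2 / (32 * m * R * √(L * (m + 8)))

/-- The last index of the iterates: the integer part of `M = 32 m L R² / ε`. -/
def outerSteps (m : ℕ) (L R ε : ℝ) : ℕ := ⌊32 * m * (L * R ^ 2 / ε)⌋₊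

namespace SupervisedPageRank

variable {V Q : Type*} [Finite V] [Fintype Q] {m₁ m₂ k : ℕ} (D : SupervisedPageRank V Q m₁ m₂ k)

/-- The number of inner steps: the integer part of
`N = (1/α) ln (2 √(2r) (2 √(2r) + 2b) / δ)` (and `0` if this is negative). -/
def innerSteps (L R ε : ℝ) : ℕ :=
  ⌊1 / D.α * Real.log
    (2 * √(2 * D.r) * (2 * √(2 * D.r) + 2 * D.b) / oracleAcc (m₁ + m₂) L R ε)⌋₊

/-- One iteration of the two-level method, from the current point and operation count, with
the random direction `s`. -/
def step (φ₀ : ParamSpace m₁ m₂) (L R ε : ℝ) (s : ParamSpace m₁ m₂)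
    (st : Counted (ParamSpace m₁ m₂)) : Counted (ParamSpace m₁ m₂) :=
  let m : ℝ := (m₁ + m₂ : ℕ)
  let μ := smoothing (m₁ + m₂) L ε
  let N := D.innerSteps L R ε
  let f₁ := D.approxLoss N (st.val + μ • s)
  let f₀ := D.approxLoss N st.val
  let g := (m / μ * (f₁.val - f₀.val)) • s
  ⟨projBall φ₀ (2 * R) (st.val - (1 / (8 * m * L)) • g), st.ops + f₁.ops + f₀.ops⟩

/-- The two-level method with the directions `s 0, s 1, …`: the iterate `φ_n` and the number of
arithmetic operations performed to compute it. -/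
def run (φ₀ : ParamSpace m₁ m₂) (L R ε : ℝ) (s : ℕ → ParamSpace m₁ m₂) :
    ℕ → Counted (ParamSpace m₁ m₂)
  | 0 => ⟨φ₀, 0⟩
  | n + 1 => D.step φ₀ L R ε (s n) (run φ₀ L R ε s n)

/-- `φ̂` is a point of smallest objective value among the iterates `φ_0, …, φ_M`. -/
def IsOutput (φ₀ : ParamSpace m₁ m₂) (L R ε : ℝ) (s : ℕ → ParamSpace m₁ m₂)
    (φhat : ParamSpace m₁ m₂) : Prop :=
  (∃ n ≤ outerSteps (m₁ + m₂) L R ε, φhat = (D.run φ₀ L R ε s n).val) ∧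
    ∀ n ≤ outerSteps (m₁ + m₂) L R ε, D.loss φhat ≤ D.loss (D.run φ₀ L R ε s n).val

end SupervisedPageRank

/-- `f` is differentiable on the set `U` with Lipschitz continuous gradient, with constant `L`,
in the sense of the quadratic bound. -/
def SmoothOn {m₁ m₂ : ℕ} (L : ℝ) (U : Set (ParamSpace m₁ m₂)) (f : ParamSpace m₁ m₂ → ℝ) : Prop :=
  ∀ y ∈ U, DifferentiableAt ℝ f y ∧
    ∀ x ∈ U, |f x - f y - inner ℝ (gradient f y) (x - y)| ≤ L / 2 * ‖x - y‖ ^ 2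

/-! ### Agreement of the definitions with their descriptions -/

theorem projBall_isNearest {m₁ m₂ : ℕ} (c x : ParamSpace m₁ m₂) {ρ : ℝ} (hρ : 0 ≤ ρ) :
    projBall c ρ x ∈ Metric.closedBall c ρ ∧
      ∀ y ∈ Metric.closedBall c ρ, ‖x - projBall c ρ x‖ ≤ ‖x - y‖ := by
  unfold projBall
  split_ifs with hx
  · exact ⟨by simpa [dist_eq_norm] using hx, fun y _ => by simp⟩
  · have hn : ρ < ‖x - c‖ := lt_of_not_ge hx
    have hp : 0 < ‖x - c‖ := lt_of_le_of_lt hρ hn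
    refine ⟨?_, fun y hy => ?_⟩
    · rw [Metric.mem_closedBall, dist_eq_norm, add_sub_cancel_left, norm_smul, norm_div,
        norm_norm, Real.norm_of_nonneg hρ, div_mul_cancel₀ _ hp.ne']
    · have h1 : x - (c + (ρ / ‖x - c‖) • (x - c)) = (1 - ρ / ‖x - c‖) • (x - c) := by
        rw [sub_smul, one_smul]; abel
      have h2 : 0 ≤ 1 - ρ / ‖x - c‖ := by
        rw [sub_nonneg, div_le_one hp]; exact hn.le
      have h3 : ‖x - c‖ ≤ ‖x - y‖ + ‖y - c‖ := by
        simpa using norm_add_le (x - y) (y - c)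
      rw [Metric.mem_closedBall, dist_eq_norm] at hy
      rw [h1, norm_smul, Real.norm_of_nonneg h2, sub_mul, one_mul, div_mul_cancel₀ _ hp.ne']
      linarith

namespace SupervisedPageRank

variable {V Q : Type*} [Finite V] {m₁ m₂ k : ℕ} (D : SupervisedPageRank V Q m₁ m₂ k)

theorem matVec_val (q : Q) (φ : ParamSpace m₁ m₂) (y : D.Vert q → ℝ) :
    (D.matVec q φ y).val = (D.transition q φ).transpose.mulVec y := by
  classical
  funext i
  simp only [matVec, Matrix.mulVec, dotProduct, Matrix.transpose_apply]
  refine Finset.sum_subset (Finset.filter_subset _ _) fun u _ hu => ?_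
  simp only [Finset.mem_filter, Finset.mem_univ, true_and, not_not] at hu
  rw [hu, zero_mul]

theorem innerLoop_power (q : Q) (φ : ParamSpace m₁ m₂) (n : ℕ) :
    (D.innerLoop q φ n).power = ((D.transition q φ).transpose ^ n).mulVec (D.restart q φ) := by
  induction n with
  | zero => simp [innerLoop]
  | succ n ih => simp [innerLoop, matVec_val, ih, Matrix.mulVec_mulVec, pow_succ']

theorem approxRank_val (N : ℕ) (q : Q) (φ : ParamSpace m₁ m₂) :
    (D.approxRank N q φ).val = (D.α / (1 - (1 - D.α) ^ (N + 1))) •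
      ∑ i ∈ Finset.range (N + 1),
        (1 - D.α) ^ i • ((D.transition q φ).transpose ^ i).mulVec (D.restart q φ) := by
  have key : ∀ n, (D.innerLoop q φ n).total = ∑ i ∈ Finset.range (n + 1),
      (1 - D.α) ^ i • ((D.transition q φ).transpose ^ i).mulVec (D.restart q φ) := by
    intro n
    induction n with
    | zero => simp [innerLoop]
    | succ n ih =>
      rw [Finset.sum_range_succ, ← ih, ← innerLoop_power]
      rfl
  simp only [approxRank, key]

/-- For nonnegative edge weights the linear system of the stationary distribution has exactly
one solution, `pageRank`. -/
theorem eq_pageRank_iff (q : Q) (φ : ParamSpace m₁ m₂)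
    (hG : ∀ u v, D.graph.Adj u v → 0 ≤ D.G q φ.edge u v) (x : D.Vert q → ℝ) :
    x = D.α • D.restart q φ + (1 - D.α) • (D.transition q φ).transpose.mulVec x ↔
      x = D.pageRank q φ := by
  classical
  have hα := D.α_pos
  have hα1 := D.α_lt_one
  have hP0 : ∀ u v, 0 ≤ D.transition q φ u v := by
    intro u v
    simp only [transition, Matrix.of_apply]
    split_ifs with h
    · refine div_nonneg (hG _ _ h.1) (Finset.sum_nonneg fun w hw => ?_)
      exact hG _ _ (Finset.mem_filter.1 hw).2.1
    · exact le_rfl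
  have hP1 : ∀ u, ∑ v, D.transition q φ u v ≤ 1 := by
    intro u
    simp only [transition, Matrix.of_apply]
    rw [← Finset.sum_filter, ← Finset.sum_div]
    exact div_self_le_one _
  have hdet : (1 - (1 - D.α) • (D.transition q φ)).det ≠ 0 := by
    apply det_ne_zero_of_sum_row_lt_diag
    intro u
    have hs : ∑ v, (1 - D.α) * D.transition q φ u v ≤ 1 - D.α := by
      rw [← Finset.mul_sum]
      nlinarith [hP1 u]
    have h1 : ∑ v ∈ Finset.univ.erase u, ‖(1 - (1 - D.α) • D.transition q φ) u v‖ =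
        ∑ v ∈ Finset.univ.erase u, (1 - D.α) * D.transition q φ u v := by
      refine Finset.sum_congr rfl fun v hv => ?_
      have : u ≠ v := (Finset.ne_of_mem_erase hv).symm
      simp only [Matrix.sub_apply, Matrix.one_apply_ne this, Matrix.smul_apply, smul_eq_mul,
        zero_sub, norm_neg]
      exact Real.norm_of_nonneg (mul_nonneg (by linarith) (hP0 _ _))
    rw [h1]
    have h2 := Finset.add_sum_erase Finset.univ
      (fun v => (1 - D.α) * D.transition q φ u v) (Finset.mem_univ u)
    simp only [Matrix.sub_apply, Matrix.one_apply_eq, Matrix.smul_apply, smul_eq_mul]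
    refine lt_of_lt_of_le ?_ (le_abs_self _)
    linarith
  set A := (1 - (1 - D.α) • (D.transition q φ).transpose) with hA
  have hAdet : IsUnit A.det := by
    have : A = (1 - (1 - D.α) • (D.transition q φ)).transpose := by
      rw [hA, Matrix.transpose_sub, Matrix.transpose_one, Matrix.transpose_smul]
    rw [this, Matrix.det_transpose]
    exact hdet.isUnit
  have hAx : A.mulVec x = x - (1 - D.α) • (D.transition q φ).transpose.mulVec x := by
    rw [hA, Matrix.sub_mulVec, Matrix.one_mulVec, Matrix.smul_mulVec]
  have hpr : D.pageRank q φ = A⁻¹.mulVec (D.α • D.restart q φ) := by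
    rw [Matrix.mulVec_smul]; rfl
  rw [hpr, ← sub_eq_iff_eq_add, ← hAx]
  constructor
  · intro h
    rw [← h, Matrix.mulVec_mulVec, Matrix.nonsing_inv_mul _ hAdet, Matrix.one_mulVec]
  · intro h
    rw [h, Matrix.mulVec_mulVec, Matrix.mul_nonsing_inv _ hAdet, Matrix.one_mulVec]

end SupervisedPageRank

end

open MeasureTheory ProbabilityTheory

noncomputable section

/-! ### The uniform distribution on the sphere -/

section Sphere

open Metric
open scoped Pointwise

variable {m₁ m₂ : ℕ}

/-! The accuracy comes from tracking the mean of `‖φ_n - φs‖²`. With `η = 1/(8mL)` and `β` the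
difference quotient along `s`, non-expansiveness of the projection leaves a cross term `-2ηmβ⟨φ_n -
φs, s⟩` and a square `η²m²β²`.

The cross term is the heart (`ConvexOn.le_integral_uniformSphere`). Instead of passing to a smoothed
function and identifying its gradient, a direction `s` is paired with its mirror image `ρ s` in the
hyperplane orthogonal to `y = x - z`. The two difference quotients combine into a symmetric
difference along `y`, centred at `x + μ p` with `p` the projection of `s` onto the hyperplane.
Convexity bounds it below by a multiple of `f(x + μp) - f(z + μp)` (`ConvexOn.le_mul_symm_sub`).
Replacing `x + μp` by `x` costs a term odd in `s`, which integrates to zero; replacing `z + μp` by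
`z` costs only `Lμ²/2`, because the gradient vanishes at `z`. The second moments of `s` then give
the mean.

The square is controlled by `E⟨g, s⟩² = ‖g‖²/m` together with `‖g‖² ≤ 2L(f x - f z)`, which has to
be proved without leaving `U` (`ConvexOn.norm_gradient_sq_le`). Independence turns the one-step
estimate into a recursion for the means, which is summed over the `M + 1` iterates.

The oracle error is an `ℓ¹` estimate: unrolling the fixed-point equation shows that the truncated
series misses the stationary distribution by at most `2(1-α)^(N+1)` (`sum_abs_fixedPoint_le`), and
the loss is Lipschitz in the scores with a constant independent of the margins
(`abs_discrepancy_sub_le`). The operation count is a deterministic bound valid for almost every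
sequence of directions. -/

theorem uniformSphere_apply {T : Set (ParamSpace m₁ m₂)} (hT : MeasurableSet T) :
    uniformSphere m₁ m₂ T =
      ((volume : Measure (ParamSpace m₁ m₂)).toSphere Set.univ)⁻¹ *
        (Module.finrank ℝ (ParamSpace m₁ m₂) *
          volume (Set.Ioo (0 : ℝ) 1 • (T ∩ sphere (0 : ParamSpace m₁ m₂) 1))) := by
  rw [uniformSphere, Measure.map_apply measurable_subtype_coe hT, Measure.smul_apply,
    Measure.toSphere_apply' _ (measurable_subtype_coe hT), Subtype.image_preimage_coe,
    Set.inter_comm, smul_eq_mul]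

/-- Positive dimension is essential: for `m = 0` the sphere is empty and the normalised measure is
zero. -/
theorem isProbabilityMeasure_uniformSphere (hm : 0 < m₁ + m₂) :
    IsProbabilityMeasure (uniformSphere m₁ m₂) := by
  have : Nontrivial (ParamSpace m₁ m₂) := by
    apply Module.nontrivial_of_finrank_pos (R := ℝ)
    simpa using hm
  constructor
  rw [uniformSphere, Measure.map_apply measurable_subtype_coe MeasurableSet.univ,
    Set.preimage_univ, Measure.smul_apply, smul_eq_mul]
  refine ENNReal.inv_mul_cancel ?_ (measure_ne_top _ _)
  rw [Ne, Measure.measure_univ_eq_zero]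
  exact Measure.toSphere_ne_zero _

theorem ae_norm_eq_one_uniformSphere : ∀ᵐ s ∂(uniformSphere m₁ m₂), ‖s‖ = 1 := by
  rw [uniformSphere, ae_map_iff measurable_subtype_coe.aemeasurable
    (measurableSet_eq_fun measurable_norm measurable_const)]
  exact Filter.Eventually.of_forall fun x => by simp

/-- Surface measure is, up to a factor, the volume of the cone over a set; a linear isometry
commutes with forming cones and preserves volume. -/
theorem map_uniformSphere (A : ParamSpace m₁ m₂ ≃ₗᵢ[ℝ] ParamSpace m₁ m₂) :
    (uniformSphere m₁ m₂).map A = uniformSphere m₁ m₂ := by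
  have hA : Measurable A := A.continuous.measurable
  ext T hT
  rw [Measure.map_apply hA hT, uniformSphere_apply (hA hT), uniformSphere_apply hT]
  congr 2
  have : Set.Ioo (0 : ℝ) 1 • (A ⁻¹' T ∩ sphere (0 : ParamSpace m₁ m₂) 1) =
      A ⁻¹' (Set.Ioo (0 : ℝ) 1 • (T ∩ sphere (0 : ParamSpace m₁ m₂) 1)) := by
    ext z
    simp only [Set.mem_smul, Set.mem_inter_iff, Set.mem_preimage, mem_sphere_zero_iff_norm]
    constructor
    · rintro ⟨a, ha, x, ⟨hx, hn⟩, rfl⟩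
      exact ⟨a, ha, A x, ⟨hx, by rw [A.norm_map, hn]⟩, (A.map_smul a x).symm⟩
    · rintro ⟨a, ha, x, ⟨hx, hn⟩, h⟩
      refine ⟨a, ha, A.symm x, ⟨by simpa using hx, by simpa using hn⟩, ?_⟩
      rw [← A.symm.map_smul, h, A.symm_apply_apply]
  rw [this]
  exact A.measurePreserving.measure_preimage_equiv (f := A.toMeasurableEquiv) _

theorem integral_comp_uniformSphere (A : ParamSpace m₁ m₂ ≃ₗᵢ[ℝ] ParamSpace m₁ m₂)
    (g : ParamSpace m₁ m₂ → ℝ) :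
    ∫ s, g (A s) ∂(uniformSphere m₁ m₂) = ∫ s, g s ∂(uniformSphere m₁ m₂) := by
  conv_rhs => rw [← map_uniformSphere A]
  exact (integral_map_equiv A.toMeasurableEquiv g).symm

/-- A measurable function bounded on the unit sphere is integrable. -/
theorem integrable_uniformSphere (hm : 0 < m₁ + m₂) {g : ParamSpace m₁ m₂ → ℝ}
    (hg : Measurable g) {C : ℝ} (hC : ∀ s, ‖s‖ = 1 → |g s| ≤ C) :
    Integrable g (uniformSphere m₁ m₂) := by
  have := isProbabilityMeasure_uniformSphere hm
  exact Integrable.of_bound hg.aestronglyMeasurable C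
    (ae_norm_eq_one_uniformSphere.mono fun s hs => hC s hs)

theorem integrable_inner_sq_uniformSphere (hm : 0 < m₁ + m₂) (v : ParamSpace m₁ m₂) :
    Integrable (fun s => inner ℝ v s ^ 2) (uniformSphere m₁ m₂) := by
  refine integrable_uniformSphere hm (by fun_prop) (C := ‖v‖ ^ 2) fun s hs => ?_
  rw [abs_pow]
  have := abs_real_inner_le_norm v s
  rw [hs, mul_one] at this
  gcongr

/-- The second moments of the uniform distribution on the sphere. -/
theorem integral_inner_sq_uniformSphere (hm : 0 < m₁ + m₂) (v : ParamSpace m₁ m₂) :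
    ∫ s, inner ℝ v s ^ 2 ∂(uniformSphere m₁ m₂) = ‖v‖ ^ 2 / (m₁ + m₂ : ℕ) := by
  have := isProbabilityMeasure_uniformSphere hm
  have key : ∀ v w : ParamSpace m₁ m₂, ‖v‖ = ‖w‖ →
      ∫ s, inner ℝ v s ^ 2 ∂(uniformSphere m₁ m₂) =
        ∫ s, inner ℝ w s ^ 2 ∂(uniformSphere m₁ m₂) := by
    intro v w h
    -- Vectors of equal norm are exchanged by a reflection, so the second moment depends on `v` only
    -- through `‖v‖`; averaging over the vectors `‖v‖ • e i` then determines it.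
    let A := (Submodule.span ℝ {v - w})ᗮ.reflection
    have hA : A v = w := Submodule.reflection_sub h
    rw [← integral_comp_uniformSphere A fun s => inner ℝ w s ^ 2]
    refine integral_congr_ae (Filter.Eventually.of_forall fun s => ?_)
    simp only [← hA, LinearIsometryEquiv.inner_map_map]
  let e : Fin m₁ ⊕ Fin m₂ → ParamSpace m₁ m₂ := fun i => EuclideanSpace.single i 1
  have hsum : ∑ i, ∫ s, inner ℝ (‖v‖ • e i) s ^ 2 ∂(uniformSphere m₁ m₂) = ‖v‖ ^ 2 := by
    rw [← integral_finsetSum _ fun i _ => integrable_inner_sq_uniformSphere hm _]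
    rw [integral_congr_ae (g := fun _ => ‖v‖ ^ 2)]
    · simp
    · filter_upwards [ae_norm_eq_one_uniformSphere] with s hs
      have h1 : ∑ i, s i ^ 2 = 1 := by
        rw [← one_pow 2, ← hs, EuclideanSpace.real_norm_sq_eq]
      simp only [inner_smul_left, e, EuclideanSpace.inner_single_left]
      simp only [map_one, one_mul, mul_pow, ← Finset.mul_sum, h1]
      simp
  have hc : ∀ i ∈ Finset.univ, ∫ s, inner ℝ (‖v‖ • e i) s ^ 2 ∂(uniformSphere m₁ m₂) =
      ∫ s, inner ℝ v s ^ 2 ∂(uniformSphere m₁ m₂) := fun i _ =>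
    key _ _ (by simp [e, norm_smul])
  rw [Finset.sum_congr rfl hc] at hsum
  rw [eq_div_iff (by positivity), mul_comm, ← hsum]
  simp

end Sphere

/-! ### Convex functions with Lipschitz continuous gradient -/

section Convex

variable {m₁ m₂ : ℕ} {f : ParamSpace m₁ m₂ → ℝ} {U : Set (ParamSpace m₁ m₂)} {L : ℝ}

theorem SmoothOn.le_add (h : SmoothOn L U f) {x y : ParamSpace m₁ m₂} (hx : x ∈ U) (hy : y ∈ U) :
    f x ≤ f y + inner ℝ (gradient f y) (x - y) + L / 2 * ‖x - y‖ ^ 2 := by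
  linarith [(abs_le.1 ((h y hy).2 x hx)).2]

theorem SmoothOn.add_le (h : SmoothOn L U f) {x y : ParamSpace m₁ m₂} (hx : x ∈ U) (hy : y ∈ U) :
    f y + inner ℝ (gradient f y) (x - y) - L / 2 * ‖x - y‖ ^ 2 ≤ f x := by
  linarith [(abs_le.1 ((h y hy).2 x hx)).1]

theorem IsLocalMin.gradient_eq_zero {x : ParamSpace m₁ m₂} (h : IsLocalMin f x) :
    gradient f x = 0 := by
  simp [gradient, h.fderiv_eq_zero]

/-- At the point `y + t(x - y)` the chord lies above the quadratic lower bound; dividing by `t` and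
letting `t → 0` removes the quadratic error. -/
theorem ConvexOn.add_inner_gradient_le (hc : ConvexOn ℝ U f) (h : SmoothOn L U f)
    {x y : ParamSpace m₁ m₂} (hx : x ∈ U) (hy : y ∈ U) :
    f y + inner ℝ (gradient f y) (x - y) ≤ f x := by
  set a := inner ℝ (gradient f y) (x - y)
  set c := L / 2 * ‖x - y‖ ^ 2
  have key : ∀ t : ℝ, 0 < t → t ≤ 1 → a - t * c ≤ f x - f y := by
    intro t ht ht1
    have hz : y + t • (x - y) ∈ U := by
      have := hc.1 hy hx (show 0 ≤ 1 - t by linarith) ht.le (by ring)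
      convert this using 1
      module
    have h1 := h.add_le hz hy
    have h2 := hc.2 hy hx (show 0 ≤ 1 - t by linarith) ht.le (by ring)
    have e : (1 - t) • y + t • x = y + t • (x - y) := by module
    rw [e] at h2
    rw [add_sub_cancel_left, inner_smul_right, norm_smul, Real.norm_of_nonneg ht.le] at h1
    simp only [smul_eq_mul] at h2
    have h3 : t * (a - t * c) ≤ t * (f x - f y) := by
      simp only [a, c]; nlinarith
    exact le_of_mul_le_mul_left h3 ht
  have hlim : Filter.Tendsto (fun t : ℝ => a - t * c) (nhdsWithin 0 (Set.Ioi 0)) (nhds a) := by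
    have : Continuous fun t : ℝ => a - t * c := by fun_prop
    simpa using (this.tendsto 0).mono_left nhdsWithin_le_nhds
  have : a ≤ f x - f y := by
    refine le_of_tendsto hlim ?_
    filter_upwards [Ioc_mem_nhdsGT (zero_lt_one' ℝ)] with t ht using key t ht.1 ht.2
  linarith

theorem ConvexOn.abs_sub_le_of_smoothOn (hc : ConvexOn ℝ U f) (h : SmoothOn L U f)
    {x s : ParamSpace m₁ m₂} {μ : ℝ} (hμ : 0 < μ) (hx : x ∈ U) (hs : ‖s‖ = 1)
    (hxs : x + μ • s ∈ U) :
    |1 / μ * (f (x + μ • s) - f x) - inner ℝ (gradient f x) s| ≤ L * μ / 2 := by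
  have h1 := hc.add_inner_gradient_le h hxs hx
  have h2 := h.le_add hxs hx
  rw [add_sub_cancel_left, inner_smul_right] at h1 h2
  rw [norm_smul, Real.norm_of_nonneg hμ.le, hs] at h2
  have e : 1 / μ * (f (x + μ • s) - f x) - inner ℝ (gradient f x) s =
      (f (x + μ • s) - f x - μ * inner ℝ (gradient f x) s) / μ := by
    field_simp
  rw [e, abs_of_nonneg (div_nonneg (by linarith) hμ.le), div_le_iff₀ hμ]
  nlinarith

/-- Lower bound for symmetric differences of a smooth convex function. -/
theorem ConvexOn.le_mul_symm_sub (hc : ConvexOn ℝ U f) (h : SmoothOn L U f) (hL : 0 ≤ L)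
    {w y : ParamSpace m₁ m₂} {τ μ : ℝ} (hτ : |τ| * ‖y‖ ≤ μ) (hw : w ∈ U) (hwy : w - y ∈ U)
    (h₁ : w + τ • y ∈ U) (h₂ : w - τ • y ∈ U) :
    2 * τ ^ 2 * (f w - f (w - y) - L * μ ^ 2 / 4) ≤
      τ * (f (w + τ • y) - f (w - τ • y)) := by
  have hμ : 0 ≤ μ := le_trans (by positivity) hτ
  wlog h0 : 0 ≤ τ generalizing τ
  -- Both sides of the inequality are even in `τ`.
  · have := this (τ := -τ) (by rwa [abs_neg]) (by rwa [neg_smul, ← sub_eq_add_neg])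
      (by rwa [neg_smul, sub_neg_eq_add]) (by linarith)
    rw [neg_smul, sub_neg_eq_add, ← sub_eq_add_neg] at this
    linarith
  rw [abs_of_nonneg h0] at hτ
  suffices h : 2 * τ * (f w - f (w - y) - L * μ ^ 2 / 4) ≤ f (w + τ • y) - f (w - τ • y) by
    calc _ = τ * (2 * τ * (f w - f (w - y) - L * μ ^ 2 / 4)) := by ring
      _ ≤ _ := mul_le_mul_of_nonneg_left h h0
  rcases le_total τ 1 with h1 | h1
  -- For `τ ≤ 1` the point `w - τy` lies between `w - y` and `w`, and convexity alone suffices: once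
  -- on that segment, once at the midpoint `w`.
  · have a1 := hc.2 hw hwy (show 0 ≤ 1 - τ by linarith) h0 (by ring)
    have a2 := hc.2 h₁ h₂ (show (0 : ℝ) ≤ 1 / 2 by norm_num) (show (0 : ℝ) ≤ 1 / 2 by norm_num)
      (by norm_num)
    have e1 : (1 - τ) • w + τ • (w - y) = w - τ • y := by module
    have e2 : (1 / 2 : ℝ) • (w + τ • y) + (1 / 2 : ℝ) • (w - τ • y) = w := by module
    rw [e1] at a1
    rw [e2] at a2
    simp only [smul_eq_mul] at a1 a2
    have : 0 ≤ τ * (L * μ ^ 2) := by positivity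
    nlinarith
  -- For `τ ≥ 1` the point `w - τy` overshoots `w - y`, so the comparison goes through the gradient
  -- at `w`. The smoothness error is affordable since `(τ‖y‖)² ≤ μ² ≤ τμ²`.
  · have a1 := hc.add_inner_gradient_le h h₁ hw
    have a2 := h.le_add h₂ hw
    have a3 := hc.add_inner_gradient_le h hwy hw
    have e1 : w - τ • y - w = -(τ • y) := by abel
    have e2 : w - y - w = -y := by abel
    rw [add_sub_cancel_left, inner_smul_right] at a1
    rw [e1, inner_neg_right, inner_smul_right, norm_neg, norm_smul, Real.norm_of_nonneg h0] at a2
    rw [e2, inner_neg_right] at a3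
    have b1 : (τ * ‖y‖) ^ 2 ≤ τ * μ ^ 2 := by
      have : (τ * ‖y‖) ^ 2 ≤ μ ^ 2 := by gcongr
      nlinarith [sq_nonneg μ]
    have b2 := mul_le_mul_of_nonneg_left b1 hL
    have b3 : τ * (f w - f (w - y)) ≤ τ * inner ℝ (gradient f w) y :=
      mul_le_mul_of_nonneg_left (by linarith) h0
    nlinarith

/-- The usual argument takes the gradient step of length `1/L`, which might leave `U`. A step `l`
does not increase the distance to the minimiser as long as `l‖g‖² ≤ 2⟨g, x - z⟩`; if `1/L` violates
this, the longest admissible step already decreases `f` too much. -/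
theorem ConvexOn.norm_gradient_sq_le (hc : ConvexOn ℝ U f) (h : SmoothOn L U f) (hL : 0 < L)
    (hU : IsOpen U) {z : ParamSpace m₁ m₂} (hmin : IsMinOn f U z) {ρ : ℝ}
    (hball : Metric.closedBall z ρ ⊆ U) {x : ParamSpace m₁ m₂} (hx : x ∈ Metric.closedBall z ρ) :
    ‖gradient f x‖ ^ 2 ≤ 2 * L * (f x - f z) := by
  have hxU := hball hx
  rw [mem_closedBall_iff_norm] at hx
  have hzU : z ∈ U := hball (Metric.mem_closedBall_self ((norm_nonneg _).trans hx))
  set g := gradient f x with hg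
  set a := inner ℝ g (x - z) with ha
  have h0 : 0 ≤ f x - f z := sub_nonneg.2 (hmin hxU)
  have h1 : f x - f z ≤ a := by
    have := hc.add_inner_gradient_le h hzU hxU
    rw [← neg_sub x z, inner_neg_right] at this
    linarith
  by_contra! hcon
  have hG : 0 < ‖g‖ ^ 2 := lt_of_le_of_lt (by positivity) hcon
  have key : ∀ l : ℝ, 0 ≤ l → l * ‖g‖ ^ 2 ≤ 2 * a →
      l * ‖g‖ ^ 2 * (1 - L * l / 2) ≤ f x - f z := by
    intro l hl hla
    have hmem : x - l • g ∈ U := by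
      apply hball
      rw [mem_closedBall_iff_norm]
      refine le_trans ?_ hx
      refine le_of_sq_le_sq ?_ (norm_nonneg _)
      have e : x - l • g - z = (x - z) - l • g := by abel
      rw [e, norm_sub_sq_real, inner_smul_right, real_inner_comm, ← ha, norm_smul, mul_pow,
        Real.norm_of_nonneg hl]
      nlinarith
    have a1 := h.le_add hmem hxU
    have a2 : f z ≤ f (x - l • g) := hmin hmem
    have e : x - l • g - x = -(l • g) := by abel
    rw [e, inner_neg_right, inner_smul_right, ← hg, real_inner_self_eq_norm_sq, norm_neg, norm_smul,
      mul_pow, Real.norm_of_nonneg hl] at a1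
    nlinarith
  rcases le_or_gt ((1 / L) * ‖g‖ ^ 2) (2 * a) with hcase | hcase
  · have := key (1 / L) (by positivity) hcase
    have e : 1 / L * ‖g‖ ^ 2 * (1 - L * (1 / L) / 2) = ‖g‖ ^ 2 / (2 * L) := by
      field_simp; norm_num
    rw [e, div_le_iff₀ (by positivity)] at this
    linarith
  -- If `a = 0`, then `f x = f z`, so `x` is a minimum too and its gradient vanishes. Otherwise `l =
  -- 2a/‖g‖² < 1/L` would lower `f` by more than `a ≥ f x - f z`, below the minimum.
  · rcases (h0.trans h1).eq_or_lt with ha0 | ha0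
    · have hxmin : IsLocalMin f x := by
        filter_upwards [hU.mem_nhds hxU] with y hy
        have : f z ≤ f y := hmin hy
        linarith
      rw [hg, IsLocalMin.gradient_eq_zero hxmin] at hG
      simp at hG
    · have := key (2 * a / ‖g‖ ^ 2) (by positivity) (by rw [div_mul_cancel₀ _ hG.ne'])
      rw [div_mul_cancel₀ _ hG.ne'] at this
      have h5 : L * (2 * a / ‖g‖ ^ 2) < 1 := by
        rw [← mul_div_assoc, div_lt_one hG]
        have := mul_lt_mul_of_pos_left hcase hL
        rwa [← mul_assoc L (1 / L), mul_one_div_cancel hL.ne', one_mul] at this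
      nlinarith

/-- The expected finite difference along a uniformly distributed direction, for a smooth convex
function: it is the gradient estimate of the random gradient-free method. -/
theorem ConvexOn.le_integral_uniformSphere (hm : 0 < m₁ + m₂) (hc : ConvexOn ℝ U f)
    (h : SmoothOn L U f) (hL : 0 ≤ L) (hf : Measurable f) {μ : ℝ} (hμ : 0 < μ)
    {x z : ParamSpace m₁ m₂} (hgrad : gradient f z = 0)
    (hxU : Metric.closedBall x μ ⊆ U) (hzU : Metric.closedBall z μ ⊆ U) :
    f x - f z - 3 / 4 * (L * μ ^ 2) ≤ ((m₁ + m₂ : ℕ) : ℝ) *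
      ∫ s, 1 / μ * (f (x + μ • s) - f x) * inner ℝ (x - z) s ∂(uniformSphere m₁ m₂) := by
  have := isProbabilityMeasure_uniformSphere hm
  set y := x - z with hy
  have hx : x ∈ U := hxU (Metric.mem_closedBall_self hμ.le)
  have hz : z ∈ U := hzU (Metric.mem_closedBall_self hμ.le)
  have hx1 : ∀ s : ParamSpace m₁ m₂, ‖s‖ ≤ 1 → x + μ • s ∈ U := fun s hs => hxU <| by
    rw [mem_closedBall_iff_norm, add_sub_cancel_left, norm_smul, Real.norm_of_nonneg hμ.le]
    nlinarith
  have hz1 : ∀ s : ParamSpace m₁ m₂, ‖s‖ ≤ 1 → z + μ • s ∈ U := fun s hs => hzU <| by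
    rw [mem_closedBall_iff_norm, add_sub_cancel_left, norm_smul, Real.norm_of_nonneg hμ.le]
    nlinarith
  rcases eq_or_ne y 0 with hy0 | hy0
  · have : x = z := sub_eq_zero.1 hy0
    have : 0 ≤ L * μ ^ 2 := by positivity
    simp [hy0, ‹x = z›, this]
  have hn : 0 < ‖y‖ := norm_pos_iff.2 hy0
  -- `ρ` reverses the component along `y` and preserves the uniform law, so `D` and `D ∘ ρ` have the
  -- same mean.
  set ρ := (Submodule.span ℝ {y})ᗮ.reflection with hρ
  have hρs : ∀ s, ρ s = s - (2 * (inner ℝ y s / ‖y‖ ^ 2)) • y := by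
    intro s
    rw [hρ, Submodule.reflection_orthogonal_apply, Submodule.reflection_singleton_apply]
    simp only [RCLike.ofReal_real_eq_id, id_eq]
    module
  have hρy : ∀ s, inner ℝ y (ρ s) = - inner ℝ y s := by
    intro s
    rw [hρs, inner_sub_right, inner_smul_right, real_inner_self_eq_norm_sq]
    field_simp; ring
  set D := fun s => 1 / μ * (f (x + μ • s) - f x) * inner ℝ y s with hD
  have hDmeas : Measurable D := by fun_prop
  have hDint : Integrable D (uniformSphere m₁ m₂) := by
    refine integrable_uniformSphere hm hDmeas (C := (‖gradient f x‖ + L * μ / 2) * ‖y‖)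
      fun s hs => ?_
    rw [hD, abs_mul]
    have h1 := hc.abs_sub_le_of_smoothOn h hμ hx hs (hx1 s hs.le)
    have h2 := abs_real_inner_le_norm (gradient f x) s
    have h3 := abs_real_inner_le_norm y s
    rw [hs, mul_one] at h2 h3
    have h4 := abs_sub_abs_le_abs_sub (1 / μ * (f (x + μ • s) - f x)) (inner ℝ (gradient f x) s)
    gcongr
    linarith
  have hDρ : Integrable (fun s => D (ρ s)) (uniformSphere m₁ m₂) := by
    have : Integrable D ((uniformSphere m₁ m₂).map ρ) := by rwa [map_uniformSphere]
    exact this.comp_measurable ρ.continuous.measurable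
  set c := f x - f z - 3 / 4 * (L * μ ^ 2) with hcdef
  set p : ParamSpace m₁ m₂ → ParamSpace m₁ m₂ := fun s => s - (inner ℝ y s / ‖y‖ ^ 2) • y with hp
  -- The first-order cost of moving the base point from `x` to `x + μ • p s`: odd in `s`, hence of
  -- mean zero.
  set o : ParamSpace m₁ m₂ → ℝ :=
    fun s => μ * (inner ℝ y s ^ 2 * inner ℝ (gradient f x) (p s)) with ho
  have hpn : ∀ s, ‖s‖ = 1 → ‖p s‖ ≤ 1 := by
    intro s hs
    have e : p s = (1 / 2 : ℝ) • (s + ρ s) := by rw [hρs, hp]; module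
    rw [e, norm_smul]
    have := norm_add_le s (ρ s)
    rw [ρ.norm_map, hs] at this
    norm_num
    linarith
  have hoint : Integrable o (uniformSphere m₁ m₂) := by
    refine integrable_uniformSphere hm (by fun_prop)
      (C := μ * (‖y‖ ^ 2 * ‖gradient f x‖)) fun s hs => ?_
    rw [ho, abs_mul, abs_mul, abs_pow, abs_of_pos hμ]
    have h2 := abs_real_inner_le_norm (gradient f x) (p s)
    have h3 := abs_real_inner_le_norm y s
    rw [hs, mul_one] at h3
    have h4 := hpn s hs
    gcongr
    exact h2.trans (mul_le_of_le_one_right (norm_nonneg _) h4)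
  have hozero : ∫ s, o s ∂(uniformSphere m₁ m₂) = 0 := by
    have h1 := integral_comp_uniformSphere (LinearIsometryEquiv.neg ℝ) o
    have h2 : ∀ s, o (LinearIsometryEquiv.neg ℝ s) = - o s := by
      intro s
      have : p (-s) = - p s := by
        simp only [hp, inner_neg_right, neg_div, neg_smul]; abel
      simp only [ho, LinearIsometryEquiv.coe_neg, inner_neg_right, this]
      ring
    simp_rw [h2, integral_neg] at h1
    linarith
  have hpt : ∀ᵐ s ∂(uniformSphere m₁ m₂),
      2 / ‖y‖ ^ 2 * (inner ℝ y s ^ 2 * c + o s) ≤ D s + D (ρ s) := by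
    filter_upwards [ae_norm_eq_one_uniformSphere] with s hs
    set t := inner ℝ y s / ‖y‖ ^ 2 with ht
    have hyt : inner ℝ y s = t * ‖y‖ ^ 2 := by rw [ht]; field_simp
    have hps := hpn s hs
    have e1 : x + μ • p s + (μ * t) • y = x + μ • s := by simp only [hp]; module
    have e2 : x + μ • p s - (μ * t) • y = x + μ • ρ s := by rw [hρs]; simp only [hp]; module
    have e3 : x + μ • p s - y = z + μ • p s := by rw [hy]; abel
    have hτ : |μ * t| * ‖y‖ ≤ μ := by
      have h3 := abs_real_inner_le_norm y s
      rw [hs, mul_one, hyt, abs_mul, abs_of_nonneg (sq_nonneg ‖y‖), pow_two, ← mul_assoc] at h3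
      have : |t| * ‖y‖ ≤ 1 := le_of_mul_le_mul_right (by linarith) hn
      rw [abs_mul, abs_of_pos hμ, mul_assoc]
      nlinarith
    -- Applied with centre `w = x + μ • p s` and `τ = μt`, where `s = p s + t • y`; then `w - y = z
    -- + μ • p s`.
    have key := hc.le_mul_symm_sub h hL hτ (hx1 _ hps) (by rw [e3]; exact hz1 _ hps)
      (by rw [e1]; exact hx1 _ hs.le) (by rw [e2]; exact hx1 _ (by rw [ρ.norm_map, hs]))
    rw [e1, e2, e3] at key
    -- The constant `3/4` is `1/2` from smoothness at `z` plus `1/4` from the symmetric difference.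
    have k1 := hc.add_inner_gradient_le h (hx1 _ hps) hx
    have k2 := h.le_add (hz1 _ hps) hz
    rw [add_sub_cancel_left, hgrad, inner_zero_left, norm_smul, Real.norm_of_nonneg hμ.le] at k2
    rw [add_sub_cancel_left, inner_smul_right] at k1
    have k3 : (μ * ‖p s‖) ^ 2 ≤ μ ^ 2 := by
      rw [mul_pow]
      exact mul_le_of_le_one_right (by positivity) (pow_le_one₀ (norm_nonneg _) hps)
    have k4 := mul_le_mul_of_nonneg_left k3 hL
    have k5 : c + μ * inner ℝ (gradient f x) (p s) ≤
        f (x + μ • p s) - f (z + μ • p s) - L * μ ^ 2 / 4 := by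
      rw [hcdef]; linarith
    have k6 : 2 * (μ * t) ^ 2 * (c + μ * inner ℝ (gradient f x) (p s)) ≤
        μ * t * (f (x + μ • s) - f (x + μ • ρ s)) :=
      (mul_le_mul_of_nonneg_left k5 (by positivity)).trans key
    have l1 : 2 / ‖y‖ ^ 2 * (inner ℝ y s ^ 2 * c + o s) =
        ‖y‖ ^ 2 / μ ^ 2 * (2 * (μ * t) ^ 2 * (c + μ * inner ℝ (gradient f x) (p s))) := by
      simp only [ho, hyt]; field_simp
    have l2 : D s + D (ρ s) =
        ‖y‖ ^ 2 / μ ^ 2 * (μ * t * (f (x + μ • s) - f (x + μ • ρ s))) := by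
      simp only [hD, hρy, hyt]; field_simp; ring
    rw [l1, l2]
    exact mul_le_mul_of_nonneg_left k6 (by positivity)
  have hsq := integrable_inner_sq_uniformSphere hm y
  have hI := integral_mono_ae (((hsq.mul_const c).add hoint).const_mul (2 / ‖y‖ ^ 2))
    (hDint.add hDρ) hpt
  have hI2 : ∫ s, (D + fun s => D (ρ s)) s ∂(uniformSphere m₁ m₂) =
      2 * ∫ s, D s ∂(uniformSphere m₁ m₂) := by
    rw [integral_add' hDint hDρ, integral_comp_uniformSphere ρ D, two_mul]
  have hI3 : ∫ s, 2 / ‖y‖ ^ 2 * (((fun s => inner ℝ y s ^ 2 * c) + o) s) ∂(uniformSphere m₁ m₂) =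
      2 * (c / (m₁ + m₂ : ℕ)) := by
    rw [integral_const_mul, integral_add' (hsq.mul_const c) hoint, hozero, integral_mul_const,
      integral_inner_sq_uniformSphere hm]
    field_simp
    simp
  have hI4 : 2 * (c / (m₁ + m₂ : ℕ)) ≤ 2 * ∫ s, D s ∂(uniformSphere m₁ m₂) := by
    rw [← hI2, ← hI3]; exact hI
  have hI5 : c / (m₁ + m₂ : ℕ) ≤ ∫ s, D s ∂(uniformSphere m₁ m₂) := by linarith
  rwa [div_le_iff₀' (by positivity)] at hI5

end Convex

/-! ### The random gradient-free method with an inexact oracle -/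

section Method

variable {m₁ m₂ : ℕ}

theorem norm_projBall_sub_le {c x z : ParamSpace m₁ m₂} {ρ : ℝ}
    (hz : z ∈ Metric.closedBall c ρ) : ‖projBall c ρ x - z‖ ≤ ‖x - z‖ := by
  rw [mem_closedBall_iff_norm] at hz
  unfold projBall
  split_ifs with hx
  · rfl
  · have hn : ρ < ‖x - c‖ := lt_of_not_ge hx
    have hρ : 0 ≤ ρ := (norm_nonneg _).trans hz
    have hp : 0 < ‖x - c‖ := hρ.trans_lt hn
    refine le_of_sq_le_sq ?_ (norm_nonneg _)
    have e1 : c + (ρ / ‖x - c‖) • (x - c) - z = (ρ / ‖x - c‖) • (x - c) - (z - c) := by abel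
    have e2 : x - z = (x - c) - (z - c) := by abel
    rw [e1, e2, norm_sub_sq_real, norm_sub_sq_real (x - c), inner_smul_left, norm_smul,
      Real.norm_of_nonneg (by positivity), div_mul_cancel₀ _ hp.ne']
    simp only [conj_trivial]
    have h1 := real_inner_le_norm (x - c) (z - c)
    have h2 : inner ℝ (x - c) (z - c) ≤ ‖x - c‖ * ρ :=
      h1.trans (mul_le_mul_of_nonneg_left hz hp.le)
    have h3 : 0 ≤ 1 - ρ / ‖x - c‖ := by
      rw [sub_nonneg, div_le_one hp]; exact hn.le
    have h4 := mul_le_mul_of_nonneg_left h2 h3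
    have h5 : (1 - ρ / ‖x - c‖) * (‖x - c‖ * ρ) = ‖x - c‖ * ρ - ρ ^ 2 := by
      field_simp
    nlinarith [sq_nonneg (‖x - c‖ - ρ)]

theorem measurable_projBall (c : ParamSpace m₁ m₂) (ρ : ℝ) : Measurable (projBall c ρ) := by
  unfold projBall
  refine Measurable.ite ?_ measurable_id (by fun_prop)
  exact measurableSet_le (by fun_prop) measurable_const

/-- One step of the random gradient-free method for the oracle `F`, with `h = 1 / (8 m L)`. -/
def gradientFreeStep (F : ParamSpace m₁ m₂ → ℝ) (c : ParamSpace m₁ m₂) (L R μ : ℝ)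
    (x s : ParamSpace m₁ m₂) : ParamSpace m₁ m₂ :=
  projBall c (2 * R) (x - (1 / (8 * ((m₁ + m₂ : ℕ) : ℝ) * L)) •
    ((((m₁ + m₂ : ℕ) : ℝ) / μ * (F (x + μ • s) - F x)) • s))

theorem measurable_gradientFreeStep {F : ParamSpace m₁ m₂ → ℝ} (hF : Measurable F)
    (c : ParamSpace m₁ m₂) (L R μ : ℝ) :
    Measurable fun z : ParamSpace m₁ m₂ × ParamSpace m₁ m₂ =>
      gradientFreeStep F c L R μ z.1 z.2 := by
  unfold gradientFreeStep
  exact (measurable_projBall c (2 * R)).comp (by fun_prop)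

theorem gradientFreeStep_mem (F : ParamSpace m₁ m₂ → ℝ) (c : ParamSpace m₁ m₂) (L μ : ℝ) {R : ℝ}
    (hR : 0 ≤ R) (x s : ParamSpace m₁ m₂) :
    gradientFreeStep F c L R μ x s ∈ Metric.closedBall c (2 * R) :=
  (projBall_isNearest _ _ (by positivity)).1

theorem smoothing_pos (m : ℕ) {L ε : ℝ} (hL : 0 < L) (hε : 0 < ε) : 0 < smoothing m L ε := by
  unfold smoothing; positivity

theorem mul_smoothing_sq (m : ℕ) {L ε : ℝ} (hL : 0 < L) (hε : 0 < ε) :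
    L * smoothing m L ε ^ 2 = 2 * ε / (m + 8) := by
  rw [smoothing, Real.sq_sqrt (by positivity)]
  field_simp

theorem oracleAcc_pos {m : ℕ} (hm : 0 < m) {L R ε : ℝ} (hL : 0 < L) (hR : 0 < R) (hε : 0 < ε) :
    0 < oracleAcc m L R ε := by
  have : (0 : ℝ) < m := by exact_mod_cast hm
  unfold oracleAcc; positivity

/-- This ratio is what the choice of `δ` is made for: a difference quotient magnifies the oracle
error by up to `2/μ`. -/
theorem oracleAcc_div_smoothing {m : ℕ} (hm : 0 < m) {L R ε : ℝ} (hL : 0 < L) (hR : 0 < R)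
    (hε : 0 < ε) : oracleAcc m L R ε / smoothing m L ε = ε / (32 * m * R) := by
  have hm' : (0 : ℝ) < m := by exact_mod_cast hm
  have h1 : ε ^ (3 / 2 : ℝ) = ε * √ε := by
    rw [Real.sqrt_eq_rpow, ← Real.rpow_one_add' hε.le (by norm_num)]
    norm_num
  have h2 : 0 < √(L * (m + 8)) := by positivity
  have h3 : 0 < √ε := by positivity
  have h4 : 0 < √(2 : ℝ) := by positivity
  have h5 : √(2 * ε / (L * (m + 8))) = √2 * √ε / √(L * (m + 8)) := by
    rw [Real.sqrt_div (by positivity), Real.sqrt_mul (by norm_num)]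
  rw [oracleAcc, smoothing, h1, h5]
  field_simp

variable {f F : ParamSpace m₁ m₂ → ℝ} {U : Set (ParamSpace m₁ m₂)} {L R ε : ℝ}
  {φ₀ φs : ParamSpace m₁ m₂}

theorem closedBall_two_mul_subset (hφ₀ : ‖φ₀ - φs‖ ≤ R) :
    Metric.closedBall φ₀ (2 * R) ⊆ Metric.closedBall φs (3 * R) := by
  apply Metric.closedBall_subset_closedBall'
  rw [dist_eq_norm]; linarith

set_option maxHeartbeats 800000 in
/-- The expected progress of one step of the method. -/
theorem integral_gradientFreeStep_le (hm : 0 < m₁ + m₂) (hL : 0 < L) (hR : 0 < R) (hε : 0 < ε)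
    (hφ₀ : ‖φ₀ - φs‖ ≤ R) (hUopen : IsOpen U)
    (hU : Metric.closedBall φs (3 * R + smoothing (m₁ + m₂) L ε) ⊆ U)
    (hmin : IsLocalMin f φs) (hc : ConvexOn ℝ U f) (h : SmoothOn L U f) (hf : Measurable f)
    (hFm : Measurable F) (hF : ∀ v ∈ U, |F v - f v| ≤ oracleAcc (m₁ + m₂) L R ε)
    (hεM : ε ≤ 32 * ((m₁ + m₂ : ℕ) : ℝ) * (L * R ^ 2))
    {x : ParamSpace m₁ m₂} (hx : x ∈ Metric.closedBall φ₀ (2 * R)) :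
    ∫ s, ‖gradientFreeStep F φ₀ L R (smoothing (m₁ + m₂) L ε) x s - φs‖ ^ 2
        ∂(uniformSphere m₁ m₂) ≤
      ‖x - φs‖ ^ 2 - 1 / (8 * ((m₁ + m₂ : ℕ) : ℝ) * L) *
        (3 / 2 * (f x - f φs) - 13 / 16 * ε) := by
  have := isProbabilityMeasure_uniformSphere hm
  have hμ := smoothing_pos (m₁ + m₂) hL hε
  have hLμ := mul_smoothing_sq (m₁ + m₂) hL hε
  have hδ := oracleAcc_pos hm hL hR hε
  have hδμ := oracleAcc_div_smoothing hm hL hR hε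
  have hmpos : (0 : ℝ) < (m₁ + m₂ : ℕ) := by exact_mod_cast hm
  have hm1 : (1 : ℝ) ≤ (m₁ + m₂ : ℕ) := by exact_mod_cast hm
  set μ := smoothing (m₁ + m₂) L ε
  set δ := oracleAcc (m₁ + m₂) L R ε
  set m : ℝ := ((m₁ + m₂ : ℕ) : ℝ) with hmdef
  set η := 1 / (8 * m * L) with hη
  have hηpos : 0 < η := by positivity
  have hφs : φs ∈ Metric.closedBall φ₀ (2 * R) := by
    rw [mem_closedBall_iff_norm, norm_sub_rev]; linarith
  have hx3 := closedBall_two_mul_subset hφ₀ hx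
  have hy3 : ‖x - φs‖ ≤ 3 * R := by rwa [mem_closedBall_iff_norm] at hx3
  have hφsU : φs ∈ U := hU (Metric.mem_closedBall_self (by positivity))
  have hminU : IsMinOn f U φs :=
    IsMinOn.of_isLocalMinOn_of_convexOn hφsU (hmin.on U) hc
  have hxball : Metric.closedBall x μ ⊆ U := by
    refine Set.Subset.trans ?_ hU
    apply Metric.closedBall_subset_closedBall'
    rw [dist_eq_norm]; linarith
  have hsball : Metric.closedBall φs μ ⊆ U :=
    (Metric.closedBall_subset_closedBall (by linarith)).trans hU
  have hxU := hxball (Metric.mem_closedBall_self hμ.le)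
  have hgrad := IsLocalMin.gradient_eq_zero hmin
  have hmain := hc.le_integral_uniformSphere hm h hL.le hf hμ hgrad hxball hsball
  have hgn := hc.norm_gradient_sq_le h hL hUopen hminU hU
    (Metric.closedBall_subset_closedBall (by linarith) hx3)
  set y := x - φs with hy
  set g := gradient f x with hg
  set A := fun s => 1 / μ * (f (x + μ • s) - f x) * inner ℝ y s with hA
  have hAint : Integrable A (uniformSphere m₁ m₂) := by
    refine integrable_uniformSphere hm (by fun_prop) (C := (‖g‖ + L * μ / 2) * ‖y‖)
      fun s hs => ?_
    rw [hA, abs_mul]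
    have hxs : x + μ • s ∈ U := hxball <| by
      rw [mem_closedBall_iff_norm, add_sub_cancel_left, norm_smul, hs, mul_one,
        Real.norm_of_nonneg hμ.le]
    have h1 := hc.abs_sub_le_of_smoothOn h hμ hxU hs hxs
    have h2 := abs_real_inner_le_norm g s
    have h3 := abs_real_inner_le_norm y s
    rw [hs, mul_one] at h2 h3
    have h4 := abs_sub_abs_le_abs_sub (1 / μ * (f (x + μ • s) - f x)) (inner ℝ g s)
    gcongr
    linarith
  have hsq := integrable_inner_sq_uniformSphere hm g
  -- The part independent of `s`: the oracle error in the cross term, then the discretisation and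
  -- oracle errors in the square.
  set K := ‖y‖ ^ 2 + 3 / 8 * η * ε + η ^ 2 * m ^ 2 * (L ^ 2 * μ ^ 2 + ε ^ 2 / (64 * m ^ 2 * R ^ 2))
    with hK
  have hpt : ∀ᵐ s ∂(uniformSphere m₁ m₂), ‖gradientFreeStep F φ₀ L R μ x s - φs‖ ^ 2 ≤
      K + (-(2 * η * m)) * A s + 2 * η ^ 2 * m ^ 2 * inner ℝ g s ^ 2 := by
    filter_upwards [ae_norm_eq_one_uniformSphere] with s hs
    have hxs : x + μ • s ∈ U := hxball <| by
      rw [mem_closedBall_iff_norm, add_sub_cancel_left, norm_smul, hs, mul_one,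
        Real.norm_of_nonneg hμ.le]
    have h1 := hc.abs_sub_le_of_smoothOn h hμ hxU hs hxs
    have h0 : ‖gradientFreeStep F φ₀ L R μ x s - φs‖ ^ 2 ≤
        ‖y - (η * (m * (1 / μ * (F (x + μ • s) - F x)))) • s‖ ^ 2 := by
      have e : y - (η * (m * (1 / μ * (F (x + μ • s) - F x)))) • s =
          x - η • ((m / μ * (F (x + μ • s) - F x)) • s) - φs := by
        rw [smul_smul, hy]
        have : m / μ * (F (x + μ • s) - F x) = m * (1 / μ * (F (x + μ • s) - F x)) := by ring
        rw [this]; abel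
      rw [e]
      have := norm_projBall_sub_le
        (x := x - η • ((m / μ * (F (x + μ • s) - F x)) • s)) hφs
      unfold gradientFreeStep
      gcongr
    refine h0.trans ?_
    rw [norm_sub_sq_real, inner_smul_right, norm_smul, hs, mul_one, Real.norm_eq_abs, sq_abs]
    set a := 1 / μ * (f (x + μ • s) - f x) with ha
    set β := 1 / μ * (F (x + μ • s) - F x) with hβ
    set u := inner ℝ g s
    have hw : |inner ℝ y s| ≤ 3 * R := by
      have h3 := abs_real_inner_le_norm y s
      rw [hs, mul_one] at h3
      exact h3.trans hy3
    have hba : |β - a| ≤ ε / (16 * m * R) := by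
      have e : β - a = 1 / μ * ((F (x + μ • s) - f (x + μ • s)) - (F x - f x)) := by
        rw [hβ, ha]; ring
      have e2 : ε / (16 * m * R) = 1 / μ * (δ + δ) := by
        have : ε / (16 * m * R) = 2 * (ε / (32 * m * R)) := by field_simp; norm_num
        rw [this, ← hδμ]; ring
      rw [e, e2, abs_mul, abs_of_pos (show 0 < 1 / μ by positivity)]
      gcongr
      exact (abs_sub _ _).trans (add_le_add (hF _ hxs) (hF _ hxU))
    have t1 : -(2 * η * m) * (β * inner ℝ y s) ≤
        -(2 * η * m) * (a * inner ℝ y s) + 3 / 8 * η * ε := by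
      have hb : |(β - a) * inner ℝ y s| ≤ ε / (16 * m * R) * (3 * R) := by
        rw [abs_mul]; gcongr
      have hb2 : ε / (16 * m * R) * (3 * R) = 3 / 16 * ε / m := by field_simp
      rw [hb2] at hb
      have hb3 := (abs_le.1 hb).1
      have hb4 := mul_le_mul_of_nonneg_left hb3 (show 0 ≤ 2 * η * m by positivity)
      have hb5 : 2 * η * m * (-(3 / 16 * ε / m)) = -(3 / 8 * η * ε) := by field_simp; norm_num
      rw [hb5] at hb4
      linarith
    -- Split `β = u + (a - u) + (β - a)` into slope, discretisation error and oracle error, and use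
    -- `(p+q+r)² ≤ 2p² + 4q² + 4r²`.
    have t2 : β ^ 2 ≤ 2 * u ^ 2 + (L ^ 2 * μ ^ 2 + ε ^ 2 / (64 * m ^ 2 * R ^ 2)) := by
      have k1 : (a - u) ^ 2 ≤ (L * μ / 2) ^ 2 := sq_le_sq' (by linarith [(abs_le.1 h1).1])
        (abs_le.1 h1).2
      have k2 : (β - a) ^ 2 ≤ (ε / (16 * m * R)) ^ 2 := sq_le_sq' (by linarith [(abs_le.1 hba).1])
        (abs_le.1 hba).2
      have k3 : ε ^ 2 / (64 * m ^ 2 * R ^ 2) = 4 * (ε / (16 * m * R)) ^ 2 := by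
        field_simp; norm_num
      have k4 : 2 * u ^ 2 + 4 * (a - u) ^ 2 + 4 * (β - a) ^ 2 - β ^ 2 =
          (u - (β - u)) ^ 2 + 2 * ((a - u) - (β - a)) ^ 2 := by ring
      rw [k3]
      linarith [sq_nonneg (u - (β - u)), sq_nonneg ((a - u) - (β - a))]
    have t3 := mul_le_mul_of_nonneg_left t2 (show 0 ≤ η ^ 2 * m ^ 2 by positivity)
    simp only [hA, hK]
    rw [← ha]
    linarith
  have hTint : Integrable (fun s => ‖gradientFreeStep F φ₀ L R μ x s - φs‖ ^ 2)
      (uniformSphere m₁ m₂) := by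
    refine integrable_uniformSphere hm ?_ (C := (3 * R) ^ 2) fun s _ => ?_
    · have := (measurable_gradientFreeStep hFm φ₀ L R μ).comp
        (measurable_prodMk_left (x := x))
      exact ((this.sub_const φs).norm).pow_const 2
    · have := closedBall_two_mul_subset hφ₀ (gradientFreeStep_mem F φ₀ L μ hR.le x s)
      rw [mem_closedBall_iff_norm] at this
      rw [abs_of_nonneg (sq_nonneg _)]
      gcongr
  have hI := integral_mono_ae hTint
    (((integrable_const K).add (hAint.const_mul (-(2 * η * m)))).add
      (hsq.const_mul (2 * η ^ 2 * m ^ 2))) hpt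
  refine hI.trans ?_
  have e1 : ∫ s, (K + (-(2 * η * m)) * A s + 2 * η ^ 2 * m ^ 2 * inner ℝ g s ^ 2)
      ∂(uniformSphere m₁ m₂) =
      K - 2 * η * (m * ∫ s, A s ∂(uniformSphere m₁ m₂)) + 2 * η ^ 2 * m ^ 2 * (‖g‖ ^ 2 / m) := by
    have hi : Integrable (fun s => K + (-(2 * η * m)) * A s) (uniformSphere m₁ m₂) :=
      (integrable_const K).add (hAint.const_mul (-(2 * η * m)))
    rw [integral_add hi (hsq.const_mul (2 * η ^ 2 * m ^ 2)), integral_add (integrable_const K)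
      (hAint.const_mul (-(2 * η * m))), integral_const_mul, integral_const_mul,
      integral_inner_sq_uniformSphere hm]
    simp only [integral_const, probReal_univ, one_smul]
    ring
  refine e1.le.trans ?_
  -- With `η = 1/(8mL)` the gradient part of the square consumes a quarter of the progress `2η(f x -
  -- f φs)`, leaving the factor `3/2`.
  have q1 : 2 * η ^ 2 * m ^ 2 * (‖g‖ ^ 2 / m) ≤ η * (1 / 2 * (f x - f φs)) := by
    have : 2 * η ^ 2 * m ^ 2 * (‖g‖ ^ 2 / m) = η * (‖g‖ ^ 2 / (4 * L)) := by
      rw [hη]; field_simp; ring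
    rw [this]
    refine mul_le_mul_of_nonneg_left ?_ hηpos.le
    rw [div_le_iff₀ (by positivity)]
    linarith
  have q2 : η ^ 2 * m ^ 2 * (L ^ 2 * μ ^ 2) = η * (m / 8 * (L * μ ^ 2)) := by
    rw [hη]; field_simp
  have q3 : η ^ 2 * m ^ 2 * (ε ^ 2 / (64 * m ^ 2 * R ^ 2)) ≤ η * (ε / 16) := by
    have : η ^ 2 * m ^ 2 * (ε ^ 2 / (64 * m ^ 2 * R ^ 2)) =
        η * (ε * (ε / (512 * m * L * R ^ 2))) := by
      rw [hη]; field_simp; norm_num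
    rw [this]
    refine mul_le_mul_of_nonneg_left ?_ hηpos.le
    rw [div_eq_mul_inv ε 16]
    refine mul_le_mul_of_nonneg_left ?_ hε.le
    rw [div_le_iff₀ (by positivity)]
    linarith
  -- The left side equals `ε(m+12)/(4(m+8))`, which explains the `m + 8` in `μ`. In total the errors
  -- are `3/8 + 3/8 + 1/16 = 13/16` times `ηε`.
  have q4 : (3 / 2 + m / 8) * (L * μ ^ 2) ≤ 3 / 8 * ε := by
    rw [hLμ, ← mul_div_assoc, div_le_iff₀ (by positivity)]
    nlinarith
  have q5 := mul_le_mul_of_nonneg_left q4 hηpos.le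
  have q6 := mul_le_mul_of_nonneg_left hmain hηpos.le
  rw [hK]
  linarith

end Method

/-! ### Iterations driven by independent random directions -/

section Iteration

variable {Ω E : Type*} [MeasurableSpace E]

/-- Factoring the `n`-th iterate through the directions of index below `n` gives both its
measurability and its independence of `dir n`. -/
theorem exists_measurable_comp_of_iterate {dir : ℕ → Ω → E} {T : E → E → E}
    (hT : Measurable fun z : E × E => T z.1 z.2) {x : ℕ → Ω → E} {x₀ : E}
    (h0 : ∀ ω, x 0 ω = x₀) (hx : ∀ n ω, x (n + 1) ω = T (x n ω) (dir n ω)) (n : ℕ) :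
    ∃ g : (Finset.range n → E) → E, Measurable g ∧
      ∀ ω, x n ω = g fun i => dir i ω := by
  induction n with
  | zero => exact ⟨fun _ => x₀, measurable_const, h0⟩
  | succ n ih =>
    obtain ⟨g, hg, hgx⟩ := ih
    refine ⟨fun v => T (g fun i => v ⟨i.1, Finset.mem_range.2
      ((Finset.mem_range.1 i.2).trans (Nat.lt_succ_self n))⟩)
      (v ⟨n, Finset.self_mem_range_succ n⟩), ?_, fun ω => by rw [hx, hgx]⟩
    refine hT.comp (Measurable.prodMk (hg.comp ?_) (measurable_pi_apply _))
    exact measurable_pi_lambda _ fun i => measurable_pi_apply _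

variable [MeasurableSpace Ω] {P : Measure Ω}

theorem measurable_iterate {dir : ℕ → Ω → E} (hdir : ∀ n, Measurable (dir n)) {T : E → E → E}
    (hT : Measurable fun z : E × E => T z.1 z.2) {x : ℕ → Ω → E} {x₀ : E}
    (h0 : ∀ ω, x 0 ω = x₀) (hx : ∀ n ω, x (n + 1) ω = T (x n ω) (dir n ω)) (n : ℕ) :
    Measurable (x n) := by
  obtain ⟨g, hg, hgx⟩ := exists_measurable_comp_of_iterate hT h0 hx n
  rw [funext hgx]
  exact hg.comp (measurable_pi_lambda _ fun i => hdir i)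

theorem indepFun_iterate {dir : ℕ → Ω → E} (hdir : ∀ n, Measurable (dir n))
    (hind : iIndepFun dir P) {T : E → E → E}
    (hT : Measurable fun z : E × E => T z.1 z.2) {x : ℕ → Ω → E} {x₀ : E}
    (h0 : ∀ ω, x 0 ω = x₀) (hx : ∀ n ω, x (n + 1) ω = T (x n ω) (dir n ω)) (n : ℕ) :
    IndepFun (x n) (dir n) P := by
  obtain ⟨g, hg, hgx⟩ := exists_measurable_comp_of_iterate hT h0 hx n
  rw [funext hgx]
  exact (hind.indepFun_finset (Finset.range n) {n} (by simp) hdir).comp hg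
    (measurable_pi_apply ⟨n, Finset.mem_singleton_self n⟩)

/-- If each step decreases the mean of `W` as prescribed by `Ψ`, the iterates do. -/
theorem integral_iterate_succ_le [IsProbabilityMeasure P] {dir : ℕ → Ω → E}
    (hdir : ∀ n, Measurable (dir n)) (hind : iIndepFun dir P) {σ : Measure E}
    (hlaw : ∀ n, P.map (dir n) = σ) {T : E → E → E}
    (hT : Measurable fun z : E × E => T z.1 z.2) {x : ℕ → Ω → E} {x₀ : E}
    (h0 : ∀ ω, x 0 ω = x₀) (hx : ∀ n ω, x (n + 1) ω = T (x n ω) (dir n ω))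
    {X : Set E} (hX : MeasurableSet X) (hxX : ∀ n ω, x n ω ∈ X)
    {W Ψ : E → ℝ} (hW : Measurable W) (hΨ : Measurable Ψ) {C : ℝ}
    (hWC : ∀ u s, |W (T u s)| ≤ C) (hΨC : ∀ u ∈ X, |Ψ u| ≤ C)
    (hstep : ∀ u ∈ X, ∫ s, W (T u s) ∂σ ≤ Ψ u) (n : ℕ) :
    ∫ ω, W (x (n + 1) ω) ∂P ≤ ∫ ω, Ψ (x n ω) ∂P := by
  have hxm := measurable_iterate hdir hT h0 hx
  have hσ : IsProbabilityMeasure σ := by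
    rw [← hlaw 0]; exact Measure.isProbabilityMeasure_map (hdir 0).aemeasurable
  have hν : IsProbabilityMeasure (P.map (x n)) :=
    Measure.isProbabilityMeasure_map (hxm n).aemeasurable
  have hprod := (indepFun_iterate hdir hind hT h0 hx n).map_prod_eq_prod_map_map
    (hxm n).aemeasurable (hdir n).aemeasurable
  rw [hlaw n] at hprod
  have hG : Measurable fun z : E × E => W (T z.1 z.2) := hW.comp hT
  have hGint : Integrable (fun z : E × E => W (T z.1 z.2)) ((P.map (x n)).prod σ) :=
    Integrable.of_bound hG.aestronglyMeasurable C
      (Filter.Eventually.of_forall fun z => hWC z.1 z.2)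
  have hae : ∀ᵐ u ∂(P.map (x n)), u ∈ X :=
    (ae_map_iff (hxm n).aemeasurable hX).2 (Filter.Eventually.of_forall fun ω => hxX n ω)
  have hΨint : Integrable Ψ (P.map (x n)) :=
    Integrable.of_bound hΨ.aestronglyMeasurable C (hae.mono fun u hu => hΨC u hu)
  calc ∫ ω, W (x (n + 1) ω) ∂P = ∫ ω, W (T (x n ω) (dir n ω)) ∂P := by simp_rw [hx]
    _ = ∫ z, W (T z.1 z.2) ∂(P.map fun ω => (x n ω, dir n ω)) :=
        (integral_map ((hxm n).prodMk (hdir n)).aemeasurable hG.aestronglyMeasurable).symm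
    _ = ∫ u, ∫ s, W (T u s) ∂σ ∂(P.map (x n)) := by rw [hprod, integral_prod _ hGint]
    _ ≤ ∫ u, Ψ u ∂(P.map (x n)) :=
        integral_mono_ae hGint.integral_prod_left hΨint (hae.mono fun u hu => hstep u hu)
    _ = ∫ ω, Ψ (x n ω) ∂P :=
        integral_map (hxm n).aemeasurable hΨ.aestronglyMeasurable

end Iteration

/-! ### Summation of the one-step estimates -/

section Convergence

variable {m₁ m₂ : ℕ} {f F : ParamSpace m₁ m₂ → ℝ} {U : Set (ParamSpace m₁ m₂)} {L R ε : ℝ}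
  {φ₀ φs : ParamSpace m₁ m₂} {Ω : Type*} [MeasurableSpace Ω] {P : Measure Ω}

/-- The mean accuracy of the best of the first iterates of the random gradient-free method. -/
theorem integral_best_iterate_sub_le [IsProbabilityMeasure P] (hm : 0 < m₁ + m₂) (hL : 0 < L)
    (hR : 0 < R) (hε : 0 < ε) (hφ₀ : ‖φ₀ - φs‖ ≤ R) (hUopen : IsOpen U)
    (hU : Metric.closedBall φs (3 * R + smoothing (m₁ + m₂) L ε) ⊆ U)
    (hmin : IsLocalMin f φs) (hc : ConvexOn ℝ U f) (h : SmoothOn L U f) (hf : Measurable f)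
    (hFm : Measurable F) (hF : ∀ v ∈ U, |F v - f v| ≤ oracleAcc (m₁ + m₂) L R ε)
    {dir : ℕ → Ω → ParamSpace m₁ m₂} (hdir : ∀ n, Measurable (dir n)) (hind : iIndepFun dir P)
    (hlaw : ∀ n, P.map (dir n) = uniformSphere m₁ m₂) {x : ℕ → Ω → ParamSpace m₁ m₂}
    (h0 : ∀ ω, x 0 ω = φ₀)
    (hx : ∀ n ω, x (n + 1) ω =
      gradientFreeStep F φ₀ L R (smoothing (m₁ + m₂) L ε) (x n ω) (dir n ω))
    {v : Ω → ℝ} (hv : ∀ ω, ∃ n ≤ outerSteps (m₁ + m₂) L R ε, v ω = f (x n ω))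
    (hvle : ∀ ω, ∀ n ≤ outerSteps (m₁ + m₂) L R ε, v ω ≤ f (x n ω)) :
    Integrable v P ∧ ∫ ω, v ω ∂P - f φs ≤ ε := by
  have hμ := smoothing_pos (m₁ + m₂) hL hε
  have hmpos : (0 : ℝ) < (m₁ + m₂ : ℕ) := by exact_mod_cast hm
  set M := outerSteps (m₁ + m₂) L R ε with hM
  set X := Metric.closedBall φ₀ (2 * R) with hX
  set T := gradientFreeStep F φ₀ L R (smoothing (m₁ + m₂) L ε) with hTdef
  have hTm : Measurable fun z : ParamSpace m₁ m₂ × ParamSpace m₁ m₂ => T z.1 z.2 :=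
    measurable_gradientFreeStep hFm φ₀ L R _
  have hTX : ∀ u s, T u s ∈ X := gradientFreeStep_mem F φ₀ L _ hR.le
  have hxX : ∀ n ω, x n ω ∈ X := by
    intro n ω
    cases n with
    | zero => rw [h0]; exact Metric.mem_closedBall_self (by positivity)
    | succ n => rw [hx]; exact hTX _ _
  have hxm := measurable_iterate hdir hTm h0 hx
  have hX3 : X ⊆ Metric.closedBall φs (3 * R) := closedBall_two_mul_subset hφ₀
  have hXU : X ⊆ U :=
    (hX3.trans (Metric.closedBall_subset_closedBall (by linarith))).trans hU
  have hφsU : φs ∈ U := hU (Metric.mem_closedBall_self (by positivity))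
  have hminU : IsMinOn f U φs :=
    IsMinOn.of_isLocalMinOn_of_convexOn hφsU (hmin.on U) hc
  have hgrad := IsLocalMin.gradient_eq_zero hmin
  have hup : ∀ u ∈ U, f u - f φs ≤ L / 2 * ‖u - φs‖ ^ 2 := by
    intro u hu
    have := h.le_add hu hφsU
    rw [hgrad, inner_zero_left] at this
    linarith
  have hlow : ∀ u ∈ U, 0 ≤ f u - f φs := fun u hu => sub_nonneg.2 (hminU hu)
  have hnX : ∀ u ∈ X, ‖u - φs‖ ^ 2 ≤ (3 * R) ^ 2 := by
    intro u hu
    have := hX3 hu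
    rw [mem_closedBall_iff_norm] at this
    gcongr
  set B := L / 2 * (3 * R) ^ 2 with hB
  have hupX : ∀ u ∈ X, f u - f φs ≤ B := fun u hu =>
    (hup u (hXU hu)).trans (by rw [hB]; exact mul_le_mul_of_nonneg_left (hnX u hu) (by positivity))
  have hfint : ∀ n, Integrable (fun ω => f (x n ω)) P := by
    intro n
    refine Integrable.of_bound (hf.comp (hxm n)).aestronglyMeasurable (|f φs| + B)
      (Filter.Eventually.of_forall fun ω => ?_)
    have h1 := hupX _ (hxX n ω)
    have h2 := hlow _ (hXU (hxX n ω))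
    rw [Real.norm_eq_abs]
    have := abs_add_le (f φs) (f (x n ω) - f φs)
    rw [abs_of_nonneg h2, add_sub_cancel] at this
    linarith
  -- The selected best point need not be measurable in `ω`, but its value is a finite minimum of
  -- measurable functions.
  have hvm : v = fun ω => (Finset.range (M + 1)).inf' Finset.nonempty_range_add_one
      fun n => f (x n ω) := by
    funext ω
    obtain ⟨n, hn, hvn⟩ := hv ω
    apply le_antisymm
    · exact Finset.le_inf' _ _ fun k hk =>
        hvle ω k (Nat.lt_succ_iff.1 (Finset.mem_range.1 hk))
    · rw [hvn]
      exact Finset.inf'_le _ (Finset.mem_range.2 (Nat.lt_succ_iff.2 hn))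
  have hvmeas : Measurable v := by
    rw [hvm]
    have : Measurable ((Finset.range (M + 1)).inf' Finset.nonempty_range_add_one
        fun n ω => f (x n ω)) :=
      Finset.inf'_induction _ _ (fun _ h₁ _ h₂ => h₁.inf h₂) fun n _ => hf.comp (hxm n)
    convert this using 1
    funext ω
    simp [Finset.inf'_apply]
  have hvint : Integrable v P := by
    refine Integrable.of_bound hvmeas.aestronglyMeasurable (|f φs| + B)
      (Filter.Eventually.of_forall fun ω => ?_)
    obtain ⟨n, hn, hvn⟩ := hv ω
    rw [hvn]
    have h1 := hupX _ (hxX n ω)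
    have h2 := hlow _ (hXU (hxX n ω))
    rw [Real.norm_eq_abs]
    have := abs_add_le (f φs) (f (x n ω) - f φs)
    rw [abs_of_nonneg h2, add_sub_cancel] at this
    linarith
  refine ⟨hvint, ?_⟩
  -- The one-step estimate needs this inequality to absorb the squared oracle error. If it fails,
  -- the starting point is already accurate, since `f φ₀ - f φs ≤ LR²/2`.
  by_cases hεM : ε ≤ 32 * ((m₁ + m₂ : ℕ) : ℝ) * (L * R ^ 2)
  · set W : ParamSpace m₁ m₂ → ℝ := fun u => ‖u - φs‖ ^ 2 with hW
    set η := 1 / (8 * ((m₁ + m₂ : ℕ) : ℝ) * L) with hη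
    have hηpos : 0 < η := by positivity
    set Ψ : ParamSpace m₁ m₂ → ℝ :=
      fun u => ‖u - φs‖ ^ 2 - η * (3 / 2 * (f u - f φs) - 13 / 16 * ε) with hΨ
    have hstep : ∀ n, ∫ ω, W (x (n + 1) ω) ∂P ≤ ∫ ω, Ψ (x n ω) ∂P := by
      refine integral_iterate_succ_le hdir hind hlaw hTm h0 hx
        (X := X) Metric.isClosed_closedBall.measurableSet hxX (by fun_prop) (by fun_prop)
        (C := (3 * R) ^ 2 + η * (3 / 2 * B + 13 / 16 * ε)) ?_ ?_ ?_
      · intro u s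
        have : 0 ≤ η * (3 / 2 * B + 13 / 16 * ε) := by positivity
        rw [abs_of_nonneg (sq_nonneg _)]
        linarith [hnX _ (hTX u s)]
      · intro u hu
        have h1 := hupX _ hu
        have h2 := hlow _ (hXU hu)
        refine (abs_sub _ _).trans (add_le_add ?_ ?_)
        · rw [abs_of_nonneg (sq_nonneg _)]
          exact hnX u hu
        · rw [abs_mul, abs_of_pos hηpos]
          refine mul_le_mul_of_nonneg_left (abs_le.2 ⟨?_, ?_⟩) hηpos.le
          · linarith
          · linarith
      · intro u hu
        exact integral_gradientFreeStep_le hm hL hR hε hφ₀ hUopen hU hmin hc h hf hFm hF hεM hu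
    have hWint : ∀ n, Integrable (fun ω => W (x n ω)) P := by
      intro n
      refine Integrable.of_bound (by
        have := hxm n
        exact Measurable.aestronglyMeasurable (by fun_prop)) ((3 * R) ^ 2)
        (Filter.Eventually.of_forall fun ω => ?_)
      rw [Real.norm_of_nonneg (sq_nonneg _)]
      exact hnX _ (hxX n ω)
    have hΨI : ∀ n, ∫ ω, Ψ (x n ω) ∂P = ∫ ω, W (x n ω) ∂P -
        η * (3 / 2 * (∫ ω, f (x n ω) ∂P - f φs) - 13 / 16 * ε) := by
      intro n
      have i1 : Integrable (fun ω => f (x n ω) - f φs) P := (hfint n).sub (integrable_const _)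
      have i2 : Integrable (fun ω => 3 / 2 * (f (x n ω) - f φs) - 13 / 16 * ε) P :=
        (i1.const_mul _).sub (integrable_const _)
      simp only [hΨ]
      rw [integral_sub (hWint n) (i2.const_mul η), integral_const_mul,
        integral_sub (i1.const_mul _) (integrable_const _), integral_const_mul,
        integral_sub (hfint n) (integrable_const _)]
      simp
    set d := ∫ ω, v ω ∂P - f φs with hd
    have hdle : ∀ n ≤ M, d ≤ ∫ ω, f (x n ω) ∂P - f φs := fun n hn =>
      sub_le_sub_right (integral_mono hvint (hfint n) fun ω => hvle ω n hn) _
    -- The sum includes a step to the iterate `M + 1`, which the method never computes, so that all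
    -- of `φ_0, …, φ_M` contribute and `M + 1` exceeds the unrounded number of steps.
    have htel : ∀ n ≤ M + 1, ∫ ω, W (x n ω) ∂P + n * (η * (3 / 2 * d - 13 / 16 * ε)) ≤ R ^ 2 := by
      intro n
      induction n with
      | zero =>
        intro _
        have : ∀ ω, W (x 0 ω) ≤ R ^ 2 := fun ω => by
          simp only [hW, h0]; gcongr
        have h2 := integral_mono (hWint 0) (integrable_const (R ^ 2)) this
        simpa using h2
      | succ n ih =>
        intro hn
        have h1 := ih (by omega)
        have h2 := hstep n
        rw [hΨI] at h2
        have h3 := mul_le_mul_of_nonneg_left (hdle n (by omega)) hηpos.le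
        push_cast
        linarith
    have hlast := htel (M + 1) le_rfl
    have hWnn : 0 ≤ ∫ ω, W (x (M + 1) ω) ∂P := integral_nonneg fun ω => sq_nonneg _
    have hM1 : 32 * ((m₁ + m₂ : ℕ) : ℝ) * (L * R ^ 2 / ε) < (M : ℝ) + 1 := by
      rw [hM, outerSteps]; exact Nat.lt_floor_add_one _
    push_cast at hlast
    have hR2 : R ^ 2 < (M + 1 : ℝ) * (η * (ε / 4)) := by
      have e : R ^ 2 = 32 * ((m₁ + m₂ : ℕ) : ℝ) * (L * R ^ 2 / ε) * (η * (ε / 4)) := by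
        rw [hη]; field_simp; ring
      rw [e]
      exact mul_lt_mul_of_pos_right hM1 (by positivity)
    -- Hence `3/2 · d < 17/16 · ε`, so `d < 17/24 · ε`.
    have h5 : (M + 1 : ℝ) * η * (3 / 2 * d - 13 / 16 * ε) < (M + 1 : ℝ) * η * (ε / 4) := by
      linarith
    have h6 := lt_of_mul_lt_mul_left h5 (by positivity)
    linarith
  · push Not at hεM
    have h1 : ∀ ω, v ω ≤ f φ₀ := fun ω => by
      have := hvle ω 0 (Nat.zero_le _)
      rwa [h0] at this
    have h2 := integral_mono hvint (integrable_const (f φ₀)) h1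
    simp only [integral_const, probReal_univ, one_smul] at h2
    have h3 := hup φ₀ (hXU (Metric.mem_closedBall_self (by positivity)))
    have h4 : ‖φ₀ - φs‖ ^ 2 ≤ R ^ 2 := by gcongr
    have h5 := mul_le_mul_of_nonneg_left h4 (show 0 ≤ L / 2 by positivity)
    have h6 : L * R ^ 2 ≤ ((m₁ + m₂ : ℕ) : ℝ) * (L * R ^ 2) :=
      le_mul_of_one_le_left (by positivity) (by exact_mod_cast hm)
    have h7 : 0 ≤ L * R ^ 2 := by positivity
    linarith

end Convergence

/-! ### Accuracy of the simple iteration -/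

section Substochastic

variable {ι : Type*} [Fintype ι]

theorem sum_abs_transpose_mulVec_le {A : Matrix ι ι ℝ} (h0 : ∀ u v, 0 ≤ A u v)
    (h1 : ∀ u, ∑ v, A u v ≤ 1) (x : ι → ℝ) :
    ∑ v, |A.transpose.mulVec x v| ≤ ∑ u, |x u| := by
  calc ∑ v, |A.transpose.mulVec x v| ≤ ∑ v, ∑ u, A u v * |x u| := by
        refine Finset.sum_le_sum fun v _ => ?_
        simp only [Matrix.mulVec, dotProduct, Matrix.transpose_apply]
        refine (Finset.abs_sum_le_sum_abs _ _).trans (Finset.sum_le_sum fun u _ => ?_)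
        rw [abs_mul, abs_of_nonneg (h0 u v)]
    _ = ∑ u, (∑ v, A u v) * |x u| := by
        rw [Finset.sum_comm]
        exact Finset.sum_congr rfl fun u _ => (Finset.sum_mul _ _ _).symm
    _ ≤ ∑ u, |x u| := Finset.sum_le_sum fun u _ =>
        mul_le_of_le_one_left (abs_nonneg _) (h1 u)

theorem sum_abs_transpose_pow_mulVec_le [DecidableEq ι] {A : Matrix ι ι ℝ}
    (h0 : ∀ u v, 0 ≤ A u v) (h1 : ∀ u, ∑ v, A u v ≤ 1) (x : ι → ℝ) (n : ℕ) :
    ∑ v, |(A.transpose ^ n).mulVec x v| ≤ ∑ u, |x u| := by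
  induction n with
  | zero => simp
  | succ n ih =>
    rw [pow_succ', ← Matrix.mulVec_mulVec]
    exact (sum_abs_transpose_mulVec_le h0 h1 _).trans ih

theorem sum_abs_add_le (x y : ι → ℝ) : ∑ i, |(x + y) i| ≤ ∑ i, |x i| + ∑ i, |y i| := by
  rw [← Finset.sum_add_distrib]
  exact Finset.sum_le_sum fun i _ => abs_add_le _ _

theorem sum_abs_smul (c : ℝ) (x : ι → ℝ) : ∑ i, |(c • x) i| = |c| * ∑ i, |x i| := by
  simp [abs_mul, Finset.mul_sum]

theorem abs_sub_le_sum_abs (x : ι → ℝ) {i j : ι} (hij : i ≠ j) :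
    |x i - x j| ≤ ∑ k, |x k| := by
  classical
  calc |x i - x j| ≤ |x i| + |x j| := abs_sub _ _
    _ = ∑ k ∈ {i, j}, |x k| := by rw [Finset.sum_pair hij]
    _ ≤ _ := Finset.sum_le_sum_of_subset_of_nonneg (Finset.subset_univ _)
      fun _ _ _ => abs_nonneg _

/-- Truncation error of the Neumann series of a fixed point of a damped substochastic matrix. -/
theorem sum_abs_fixedPoint_le [DecidableEq ι] {A : Matrix ι ι ℝ} (h0 : ∀ u v, 0 ≤ A u v)
    (h1 : ∀ u, ∑ v, A u v ≤ 1) {α : ℝ} (hα : 0 < α) (hα1 : α < 1) {ρ x : ι → ℝ}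
    (hρ : ∑ i, |ρ i| ≤ 1) (hx : x = α • ρ + (1 - α) • A.transpose.mulVec x) (N : ℕ) :
    let y := (α / (1 - (1 - α) ^ (N + 1))) • ∑ i ∈ Finset.range (N + 1),
        (1 - α) ^ i • (A.transpose ^ i).mulVec ρ
    ∑ i, |x i| ≤ 1 ∧ ∑ i, |y i| ≤ 1 ∧ ∑ i, |(y - x) i| ≤ 2 * (1 - α) ^ (N + 1) := by
  intro y
  have hβ : 0 < 1 - α := by linarith
  have hx1 : ∑ i, |x i| ≤ 1 := by
    have a1 : ∑ i, |x i| ≤ α * ∑ i, |ρ i| + (1 - α) * ∑ i, |A.transpose.mulVec x i| := by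
      calc ∑ i, |x i| = ∑ i, |(α • ρ + (1 - α) • A.transpose.mulVec x) i| := by rw [← hx]
        _ ≤ _ := by
          refine (sum_abs_add_le _ _).trans_eq ?_
          rw [sum_abs_smul, sum_abs_smul, abs_of_pos hα, abs_of_pos hβ]
    have a2 := mul_le_mul_of_nonneg_left (sum_abs_transpose_mulVec_le h0 h1 x) hβ.le
    have a3 := mul_le_mul_of_nonneg_left hρ hα.le
    have a4 : α * ∑ i, |x i| ≤ α * 1 := by linarith
    exact le_of_mul_le_mul_left a4 hα
  set S : ℕ → ι → ℝ := fun n => ∑ i ∈ Finset.range n, (1 - α) ^ i • (A.transpose ^ i).mulVec ρ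
    with hS
  -- The fixed-point equation unrolled `n` times; no invertibility or convergence of a series is
  -- needed.
  have hexp : ∀ n, x = α • S n + (1 - α) ^ n • (A.transpose ^ n).mulVec x := by
    intro n
    induction n with
    | zero => simp [hS]
    | succ n ih =>
      have e : (A.transpose ^ n).mulVec x = α • (A.transpose ^ n).mulVec ρ +
          (1 - α) • (A.transpose ^ (n + 1)).mulVec x := by
        conv_lhs => rw [hx]
        rw [Matrix.mulVec_add, Matrix.mulVec_smul, Matrix.mulVec_smul, Matrix.mulVec_mulVec,
          pow_succ]
      have e2 : S (n + 1) = S n + (1 - α) ^ n • (A.transpose ^ n).mulVec ρ :=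
        Finset.sum_range_succ _ _
      conv_lhs => rw [ih]
      rw [e, e2]
      module
  set c := (1 - α) ^ (N + 1) with hc
  have hc0 : 0 < c := by positivity
  have hc1 : c < 1 := pow_lt_one₀ hβ.le (by linarith) (Nat.succ_ne_zero N)
  have hSn : α * ∑ i, |S (N + 1) i| ≤ 1 - c := by
    have a1 : ∑ i, |S (N + 1) i| ≤ ∑ n ∈ Finset.range (N + 1), (1 - α) ^ n := by
      calc ∑ i, |S (N + 1) i| ≤
          ∑ i, ∑ n ∈ Finset.range (N + 1), |((1 - α) ^ n • (A.transpose ^ n).mulVec ρ) i| := by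
            refine Finset.sum_le_sum fun i _ => ?_
            simp only [hS, Finset.sum_apply]
            exact Finset.abs_sum_le_sum_abs _ _
        _ = ∑ n ∈ Finset.range (N + 1), (1 - α) ^ n * ∑ i, |(A.transpose ^ n).mulVec ρ i| := by
            rw [Finset.sum_comm]
            refine Finset.sum_congr rfl fun n _ => ?_
            rw [sum_abs_smul, abs_of_nonneg (by positivity)]
        _ ≤ _ := Finset.sum_le_sum fun n _ => mul_le_of_le_one_right (by positivity)
            ((sum_abs_transpose_pow_mulVec_le h0 h1 ρ n).trans hρ)
    have a2 := mul_neg_geom_sum (1 - α) (N + 1)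
    rw [sub_sub_cancel] at a2
    rw [hc, ← a2]
    exact mul_le_mul_of_nonneg_left a1 hα.le
  have hy : y = (α / (1 - c)) • S (N + 1) := rfl
  have h1c : 0 < 1 - c := by linarith
  have hyn : ∑ i, |y i| ≤ 1 := by
    rw [hy, sum_abs_smul, abs_of_pos (by positivity), div_mul_eq_mul_div, div_le_one h1c]
    exact hSn
  refine ⟨hx1, hyn, ?_⟩
  -- The normalisation `1/(1-c)` makes the error exactly `c` times a difference of two vectors of
  -- `ℓ¹` norm at most `1`.
  have e : y - x = c • y + (-c) • (A.transpose ^ (N + 1)).mulVec x := by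
    have e1 : (1 - c) • y = α • S (N + 1) := by
      rw [hy, smul_smul, mul_div_cancel₀ _ h1c.ne']
    conv_lhs => rw [hexp (N + 1), ← e1]
    module
  rw [e]
  refine (sum_abs_add_le _ _).trans ?_
  rw [sum_abs_smul c y, sum_abs_smul (-c), abs_neg, abs_of_pos hc0]
  have a1 := mul_le_mul_of_nonneg_left hyn hc0.le
  have a2 := mul_le_mul_of_nonneg_left
    ((sum_abs_transpose_pow_mulVec_le h0 h1 x (N + 1)).trans hx1) hc0.le
  linarith

end Substochastic

/-! ### From ranking accuracy to oracle accuracy -/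

namespace SupervisedPageRank

variable {V Q : Type*} {m₁ m₂ k : ℕ} (D : SupervisedPageRank V Q m₁ m₂ k)

/-- For arguments at least `-1` a positive margin keeps the clipped values in `[-1, 0]`, so squaring
has Lipschitz constant `2` whatever the margin. -/
theorem abs_h_sub_h_le {j₁ j₂ : Fin k} (hj : j₂ < j₁) {x y : ℝ} (hx : -1 ≤ x) (hy : -1 ≤ y) :
    |D.h j₁ j₂ x - D.h j₁ j₂ y| ≤ 2 * |x - y| := by
  have hb := D.margin_pos j₁ j₂ hj
  unfold h
  set c := D.margin j₁ j₂
  have h1 : |min (x + c) 0 - min (y + c) 0| ≤ |x - y| := by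
    have := abs_min_sub_min_le_max (x + c) 0 (y + c) 0
    simpa using this
  have h2 : |min (x + c) 0 + min (y + c) 0| ≤ 2 := by
    have l1 : -1 ≤ min (x + c) 0 := le_min (by linarith) (by norm_num)
    have l2 : -1 ≤ min (y + c) 0 := le_min (by linarith) (by norm_num)
    have u1 := min_le_right (x + c) 0
    have u2 := min_le_right (y + c) 0
    rw [abs_le]; constructor <;> linarith
  rw [sq_sub_sq, abs_mul]
  gcongr

variable [Finite V]

theorem transition_nonneg {q : Q} {φ : ParamSpace m₁ m₂}
    (hG : ∀ u v, D.graph.Adj u v → 0 ≤ D.G q φ.edge u v) (u v : D.Vert q) :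
    0 ≤ D.transition q φ u v := by
  classical
  simp only [transition, Matrix.of_apply]
  split_ifs with h
  · refine div_nonneg (hG _ _ h.1) (Finset.sum_nonneg fun w hw => ?_)
    exact hG _ _ (Finset.mem_filter.1 hw).2.1
  · exact le_rfl

/-- Only an inequality: by `0 / 0 = 0` a row whose total weight vanishes is zero. No sign condition
is needed. -/
theorem sum_transition_le_one (q : Q) (φ : ParamSpace m₁ m₂) (u : D.Vert q) :
    ∑ v, D.transition q φ u v ≤ 1 := by
  simp only [transition, Matrix.of_apply]
  rw [← Finset.sum_filter, ← Finset.sum_div]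
  exact div_self_le_one _

theorem sum_abs_restart_le_one {q : Q} {φ : ParamSpace m₁ m₂}
    (hF : ∀ i, 0 ≤ D.F q φ.node i) : ∑ i, |D.restart q φ i| ≤ 1 := by
  have : ∀ i, |D.restart q φ i| = D.restart q φ i := fun i => by
    refine abs_of_nonneg ?_
    unfold restart
    split_ifs
    · exact div_nonneg (hF _) (Finset.sum_nonneg fun j _ => hF _)
    · exact le_rfl
  rw [Finset.sum_congr rfl fun i _ => this i]
  unfold restart
  rw [← Finset.sum_filter, ← Finset.sum_div]
  exact div_self_le_one _

theorem sum_abs_approxRank_sub_le {q : Q} {φ : ParamSpace m₁ m₂}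
    (hF : ∀ i, 0 ≤ D.F q φ.node i) (hG : ∀ u v, D.graph.Adj u v → 0 ≤ D.G q φ.edge u v)
    (N : ℕ) :
    ∑ i, |D.pageRank q φ i| ≤ 1 ∧ ∑ i, |(D.approxRank N q φ).val i| ≤ 1 ∧
      ∑ i, |((D.approxRank N q φ).val - D.pageRank q φ) i| ≤ 2 * (1 - D.α) ^ (N + 1) := by
  rw [approxRank_val]
  exact sum_abs_fixedPoint_le (D.transition_nonneg hG) (D.sum_transition_le_one q φ) D.α_pos
    D.α_lt_one (D.sum_abs_restart_le_one hF) ((D.eq_pageRank_iff q φ hG _).2 rfl) N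

theorem b_nonneg : 0 ≤ D.b := Real.iSup_nonneg fun _ => Real.sqrt_nonneg _

theorem measurable_restart (hF : ∀ q i, Measurable fun φ₁ => D.F q φ₁ i) (q : Q)
    (i : D.Vert q) : Measurable fun φ : ParamSpace m₁ m₂ => D.restart q φ i := by
  have hn : Measurable (ParamSpace.node : ParamSpace m₁ m₂ → Fin m₁ → ℝ) :=
    measurable_pi_lambda _ fun i => by unfold ParamSpace.node; fun_prop
  unfold restart
  split_ifs
  · exact ((hF q i.1).comp hn).div (Finset.measurable_fun_sum _ fun j _ => (hF q j.1).comp hn)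
  · exact measurable_const

theorem measurable_transition (hG : ∀ q i j, D.graph.Adj i j → Measurable fun φ₂ => D.G q φ₂ i j)
    (q : Q) (u v : D.Vert q) : Measurable fun φ : ParamSpace m₁ m₂ => D.transition q φ u v := by
  have hn : Measurable (ParamSpace.edge : ParamSpace m₁ m₂ → Fin m₂ → ℝ) :=
    measurable_pi_lambda _ fun i => by unfold ParamSpace.edge; fun_prop
  classical
  simp only [transition, Matrix.of_apply]
  split_ifs with h
  · exact ((hG q _ _ h.1).comp hn).div (Finset.measurable_fun_sum _ fun w hw =>
      (hG q _ _ (Finset.mem_filter.1 hw).2.1).comp hn)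
  · exact measurable_const

theorem measurable_innerLoop (hF : ∀ q i, Measurable fun φ₁ => D.F q φ₁ i)
    (hG : ∀ q i j, D.graph.Adj i j → Measurable fun φ₂ => D.G q φ₂ i j) (q : Q) (n : ℕ)
    (i : D.Vert q) :
    (Measurable fun φ : ParamSpace m₁ m₂ => (D.innerLoop q φ n).power i) ∧
      Measurable fun φ : ParamSpace m₁ m₂ => (D.innerLoop q φ n).total i := by
  induction n generalizing i with
  | zero => exact ⟨D.measurable_restart hF q i, D.measurable_restart hF q i⟩
  | succ n ih =>
    have h1 : Measurable fun φ : ParamSpace m₁ m₂ => (D.innerLoop q φ (n + 1)).power i := by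
      simp only [innerLoop, matVec_val, Matrix.mulVec, dotProduct, Matrix.transpose_apply]
      exact Finset.measurable_fun_sum _ fun u _ => (D.measurable_transition hG q u i).mul (ih u).1
    exact ⟨h1, (ih i).2.add (h1.const_mul ((1 - D.α) ^ (n + 1)))⟩

variable [Fintype Q]

theorem abs_discrepancy_sub_le [Nonempty Q] {x y : ∀ q, D.Vert q → ℝ} {Δ : ℝ} (hΔ : 0 ≤ Δ)
    (hx : ∀ q, ∑ i, |x q i| ≤ 1) (hy : ∀ q, ∑ i, |y q i| ≤ 1)
    (hxy : ∀ q, ∑ i, |(x q - y q) i| ≤ Δ) :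
    |D.discrepancy x - D.discrepancy y| ≤ 2 * D.r * Δ := by
  classical
  have hcard : (0 : ℝ) < Fintype.card Q := by exact_mod_cast Fintype.card_pos
  have hq : ∀ q, |∑ t ∈ D.pairs q, D.h t.1 t.2.1 (x q t.2.2.2 - x q t.2.2.1) -
      ∑ t ∈ D.pairs q, D.h t.1 t.2.1 (y q t.2.2.2 - y q t.2.2.1)| ≤ 2 * D.r * Δ := by
    intro q
    rw [← Finset.sum_sub_distrib]
    have ht : ∀ t ∈ D.pairs q, |D.h t.1 t.2.1 (x q t.2.2.2 - x q t.2.2.1) -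
        D.h t.1 t.2.1 (y q t.2.2.2 - y q t.2.2.1)| ≤ 2 * Δ := by
      intro t ht
      obtain ⟨h1, h2, h3⟩ := (Finset.mem_filter.1 ht).2
      -- A vertex has one label, so the two vertices differ and their score difference is bounded by
      -- the `ℓ¹` norm itself, not by twice it.
      have hne : t.2.2.2 ≠ t.2.2.1 := by
        intro he
        unfold Judged at h2 h3
        rw [he, h2] at h3
        exact h1.ne (Fin.rev_injective (Option.some.inj h3)).symm
      have a1 := (abs_le.1 ((abs_sub_le_sum_abs (x q) hne).trans (hx q))).1
      have a2 := (abs_le.1 ((abs_sub_le_sum_abs (y q) hne).trans (hy q))).1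
      have a3 := (abs_sub_le_sum_abs (x q - y q) hne).trans (hxy q)
      refine (D.abs_h_sub_h_le h1 a1 a2).trans ?_
      have e : x q t.2.2.2 - x q t.2.2.1 - (y q t.2.2.2 - y q t.2.2.1) =
          (x q - y q) t.2.2.2 - (x q - y q) t.2.2.1 := by
        simp only [Pi.sub_apply]; ring
      rw [e]
      gcongr
    have hr : ((D.pairs q).card : ℝ) ≤ D.r := by
      exact_mod_cast Finset.le_sup (f := fun q => (D.pairs q).card) (Finset.mem_univ q)
    calc _ ≤ ∑ t ∈ D.pairs q, 2 * Δ :=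
          (Finset.abs_sum_le_sum_abs _ _).trans (Finset.sum_le_sum ht)
      _ = (D.pairs q).card * (2 * Δ) := by rw [Finset.sum_const, nsmul_eq_mul]
      _ ≤ D.r * (2 * Δ) := by gcongr
      _ = _ := by ring
  unfold discrepancy
  rw [← mul_sub, ← Finset.sum_sub_distrib, abs_mul, abs_of_pos (by positivity), one_div,
    inv_mul_le_iff₀ hcard]
  calc _ ≤ ∑ q : Q, 2 * D.r * Δ :=
        (Finset.abs_sum_le_sum_abs _ _).trans (Finset.sum_le_sum fun q _ => hq q)
    _ = _ := by rw [Finset.sum_const, nsmul_eq_mul]; rfl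

theorem pow_innerSteps_le (hm : 0 < m₁ + m₂) {L R ε : ℝ} (hL : 0 < L) (hR : 0 < R) (hε : 0 < ε) :
    4 * D.r * (1 - D.α) ^ (D.innerSteps L R ε + 1) ≤ oracleAcc (m₁ + m₂) L R ε := by
  have hδ := oracleAcc_pos hm hL hR hε
  have hα := D.α_pos
  have hα1 := D.α_lt_one
  have hb := D.b_nonneg
  set δ := oracleAcc (m₁ + m₂) L R ε with hδdef
  rcases Nat.eq_zero_or_pos D.r with hr | hr
  · rw [hr]; simpa using hδ.le
  have hr' : (0 : ℝ) < D.r := by exact_mod_cast hr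
  set B := 2 * √(2 * D.r) * (2 * √(2 * D.r) + 2 * D.b) / δ with hB
  set N := D.innerSteps L R ε with hN
  have hsq : √(2 * (D.r : ℝ)) ^ 2 = 2 * D.r := Real.sq_sqrt (by positivity)
  have hBpos : 0 < B := by positivity
  -- This holds also for a negative logarithm, where the floor is `0`.
  have h1 : 1 / D.α * Real.log B < N + 1 := Nat.lt_floor_add_one _
  have h2 : Real.log B ≤ D.α * (N + 1) := by
    rw [one_div, inv_mul_lt_iff₀ hα] at h1
    exact h1.le
  have h3 : (1 - D.α) ^ (N + 1) ≤ B⁻¹ := by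
    have a1 : 1 - D.α ≤ Real.exp (-D.α) := by linarith [Real.add_one_le_exp (-D.α)]
    calc (1 - D.α) ^ (N + 1) ≤ Real.exp (-D.α) ^ (N + 1) :=
          pow_le_pow_left₀ (by linarith) a1 _
      _ = Real.exp (-(D.α * (N + 1))) := by
          rw [← Real.exp_nat_mul]; congr 1; push_cast; ring
      _ ≤ Real.exp (-Real.log B) := Real.exp_le_exp.2 (by linarith)
      _ = B⁻¹ := by rw [Real.exp_neg, Real.exp_log hBpos]
  -- The term with `b` is simply dropped; the logarithm contains more than the accuracy requires.
  have h4 : 8 * D.r / δ ≤ B := by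
    rw [hB]
    refine div_le_div_of_nonneg_right ?_ hδ.le
    have : 0 ≤ √(2 * (D.r : ℝ)) * D.b := by positivity
    nlinarith
  have h5 : 4 * D.r * B⁻¹ ≤ δ := by
    rw [← div_eq_mul_inv, div_le_iff₀ hBpos]
    rw [div_le_iff₀ hδ] at h4
    linarith
  exact (mul_le_mul_of_nonneg_left h3 (by positivity)).trans h5

/-- The oracle computed with the prescribed number of inner steps has the prescribed accuracy. -/
theorem abs_approxLoss_sub_loss_le [Nonempty Q] (hm : 0 < m₁ + m₂) {L R ε : ℝ} (hL : 0 < L)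
    (hR : 0 < R) (hε : 0 < ε) {φ : ParamSpace m₁ m₂} (hF : ∀ q i, 0 ≤ D.F q φ.node i)
    (hG : ∀ q u v, D.graph.Adj u v → 0 ≤ D.G q φ.edge u v) :
    |(D.approxLoss (D.innerSteps L R ε) φ).val - D.loss φ| ≤ oracleAcc (m₁ + m₂) L R ε := by
  have hα1 := D.α_lt_one
  have key := fun q => D.sum_abs_approxRank_sub_le (hF q) (hG q) (D.innerSteps L R ε)
  refine (D.abs_discrepancy_sub_le
    (mul_nonneg zero_le_two (pow_nonneg (by linarith) _)) (fun q => (key q).2.1)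
    (fun q => (key q).1) fun q => (key q).2.2).trans ?_
  refine le_trans (le_of_eq ?_) (D.pow_innerSteps_le hm hL hR hε)
  ring

/-! ### Measurability and operation counts -/

theorem measurable_discrepancy {x : ParamSpace m₁ m₂ → ∀ q, D.Vert q → ℝ}
    (hx : ∀ q i, Measurable fun φ => x φ q i) : Measurable fun φ => D.discrepancy (x φ) := by
  unfold discrepancy h
  refine (Finset.measurable_fun_sum _ fun q _ =>
    Finset.measurable_fun_sum _ fun t _ => ?_).const_mul _
  exact ((((hx q _).sub (hx q _)).add_const _).min measurable_const).pow_const 2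

theorem measurable_approxLoss (hF : ∀ q i, Measurable fun φ₁ => D.F q φ₁ i)
    (hG : ∀ q i j, D.graph.Adj i j → Measurable fun φ₂ => D.G q φ₂ i j) (N : ℕ) :
    Measurable fun φ : ParamSpace m₁ m₂ => (D.approxLoss N φ).val :=
  D.measurable_discrepancy fun q i => (D.measurable_innerLoop hF hG q N i).2.const_mul _

end SupervisedPageRank

/-! ### Measurability of determinants and matrix inverses -/

theorem Matrix.measurable_det {ι X : Type*} [Fintype ι] [DecidableEq ι] [MeasurableSpace X]
    {A : X → Matrix ι ι ℝ} (hA : ∀ i j, Measurable fun x => A x i j) :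
    Measurable fun x => (A x).det := by
  simp only [Matrix.det_apply]
  exact Finset.measurable_fun_sum _ fun τ _ =>
    (Finset.measurable_fun_prod _ fun i _ => hA _ _).const_smul (Equiv.Perm.sign τ)

/-- Cramer's rule; singular matrices are included, as the inverse of a zero determinant is `0`. This
matters because the loss has to be measurable outside `U` as well. -/
theorem Matrix.measurable_inv_apply {ι X : Type*} [Fintype ι] [DecidableEq ι] [MeasurableSpace X]
    {A : X → Matrix ι ι ℝ} (hA : ∀ i j, Measurable fun x => A x i j) (i j : ι) :
    Measurable fun x => (A x)⁻¹ i j := by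
  simp only [Matrix.inv_def, Ring.inverse_eq_inv', Matrix.smul_apply, smul_eq_mul,
    Matrix.adjugate_apply]
  refine (Matrix.measurable_det hA).inv.mul (Matrix.measurable_det fun k l => ?_)
  simp only [Matrix.updateRow_apply]
  split_ifs
  · exact measurable_const
  · exact hA k l

namespace SupervisedPageRank

variable {V Q : Type*} [Finite V] {m₁ m₂ k : ℕ} (D : SupervisedPageRank V Q m₁ m₂ k)

theorem measurable_matVec_ops (hG : ∀ q i j, D.graph.Adj i j → Measurable fun φ₂ => D.G q φ₂ i j)
    (q : Q) {X : ParamSpace m₁ m₂ → D.Vert q → ℝ} :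
    Measurable fun φ : ParamSpace m₁ m₂ => (D.matVec q φ (X φ)).ops := by
  simp only [matVec, Finset.card_filter]
  refine Finset.measurable_fun_sum _ fun i _ => Finset.measurable_fun_sum _ fun u _ => ?_
  refine Measurable.ite ?_ measurable_const measurable_const
  exact (measurableSet_eq_fun (D.measurable_transition hG q u i) measurable_const).compl

theorem measurable_innerLoop_ops
    (hG : ∀ q i j, D.graph.Adj i j → Measurable fun φ₂ => D.G q φ₂ i j) (q : Q) (n : ℕ) :
    Measurable fun φ : ParamSpace m₁ m₂ => (D.innerLoop q φ n).ops := by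
  induction n with
  | zero => exact measurable_const
  | succ n ih => exact ih.add (D.measurable_matVec_ops hG q)

variable [Fintype Q]

theorem measurable_loss (hF : ∀ q i, Measurable fun φ₁ => D.F q φ₁ i)
    (hG : ∀ q i j, D.graph.Adj i j → Measurable fun φ₂ => D.G q φ₂ i j) :
    Measurable (D.loss : ParamSpace m₁ m₂ → ℝ) := by
  refine D.measurable_discrepancy fun q i => ?_
  simp only [pageRank, Pi.smul_apply, smul_eq_mul, Matrix.mulVec, dotProduct]
  refine (Finset.measurable_fun_sum _ fun j _ =>
    Measurable.mul ?_ (D.measurable_restart hF q j)).const_mul D.α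
  refine Matrix.measurable_inv_apply (fun u v => ?_) i j
  simp only [Matrix.sub_apply, Matrix.smul_apply, Matrix.transpose_apply, smul_eq_mul]
  exact ((D.measurable_transition hG q v u).const_mul (1 - D.α)).const_sub _

theorem measurable_approxLoss_ops
    (hG : ∀ q i j, D.graph.Adj i j → Measurable fun φ₂ => D.G q φ₂ i j) (N : ℕ) :
    Measurable fun φ : ParamSpace m₁ m₂ => (D.approxLoss N φ).ops :=
  Finset.measurable_fun_sum _ fun q _ => D.measurable_innerLoop_ops hG q N

/-! ### Bounds on the number of operations -/

theorem matVec_ops_le {q : Q} {φ : ParamSpace m₁ m₂} {s : ℕ} (hs : D.sparsity q φ ≤ s)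
    (y : D.Vert q → ℝ) : (D.matVec q φ y).ops ≤ D.p * s := by
  classical
  have h1 : ∀ i ∈ Finset.univ,
      (Finset.univ.filter fun u : D.Vert q => D.transition q φ u i ≠ 0).card ≤ s := fun i hi =>
    (Finset.le_sup (f := fun i : D.Vert q =>
      (Finset.univ.filter fun u : D.Vert q => D.transition q φ u i ≠ 0).card) hi).trans
      (le_trans (le_of_eq (by unfold SupervisedPageRank.sparsity; congr!)) hs)
  have h2 : Fintype.card (D.Vert q) ≤ D.p :=
    Finset.le_sup (f := fun q => Fintype.card (D.Vert q)) (Finset.mem_univ q)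
  have h3 := Finset.sum_le_card_nsmul _ _ _ h1
  rw [smul_eq_mul, Finset.card_univ] at h3
  refine le_trans (le_of_eq ?_) (h3.trans (Nat.mul_le_mul_right s h2))
  unfold matVec
  congr!

theorem innerLoop_ops_le {q : Q} {φ : ParamSpace m₁ m₂} {s : ℕ} (hs : D.sparsity q φ ≤ s)
    (n : ℕ) : (D.innerLoop q φ n).ops ≤ n * (D.p * s) := by
  induction n with
  | zero => simp [innerLoop]
  | succ n ih =>
    rw [Nat.succ_mul]
    exact Nat.add_le_add ih (D.matVec_ops_le hs _)

theorem approxLoss_ops_le {φ : ParamSpace m₁ m₂} {s : ℕ} (hs : ∀ q, D.sparsity q φ ≤ s)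
    (N : ℕ) : (D.approxLoss N φ).ops ≤ Fintype.card Q * (N * (D.p * s)) := by
  have := Finset.sum_le_card_nsmul Finset.univ (fun q => (D.approxRank N q φ).ops)
    (N * (D.p * s)) fun q _ => D.innerLoop_ops_le (hs q) N
  rwa [smul_eq_mul, Finset.card_univ] at this

theorem innerSteps_le (L R ε : ℝ) :
    (D.innerSteps L R ε : ℝ) ≤ 1 / D.α * max 0 (Real.log
      (4 * (2 * D.r + D.b * √(2 * D.r)) *
        (32 * (m₁ + m₂ : ℕ) * R * √(L * ((m₁ + m₂ : ℕ) + 8)) /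
          (ε ^ (3 / 2 : ℝ) * √2)))) := by
  have hα := D.α_pos
  have e : 2 * √(2 * D.r) * (2 * √(2 * D.r) + 2 * D.b) / oracleAcc (m₁ + m₂) L R ε =
      4 * (2 * D.r + D.b * √(2 * D.r)) *
        (32 * (m₁ + m₂ : ℕ) * R * √(L * ((m₁ + m₂ : ℕ) + 8)) / (ε ^ (3 / 2 : ℝ) * √2)) := by
    have hsq : √(2 * (D.r : ℝ)) ^ 2 = 2 * D.r := Real.sq_sqrt (by positivity)
    have e2 : 2 * √(2 * D.r) * (2 * √(2 * D.r) + 2 * D.b) =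
        4 * (2 * (D.r : ℝ) + D.b * √(2 * D.r)) := by
      rw [← hsq, Real.sqrt_sq (Real.sqrt_nonneg _)]; ring
    rw [e2, oracleAcc, div_eq_mul_inv _ (_ / _), inv_div]
  rw [innerSteps, e]
  -- The maximum with `0` enters before the floor is removed, since a natural floor is bounded by
  -- its argument only for non-negative arguments. For `r = 0` the convention `Real.log 0 = 0` gives
  -- the stated value.
  refine le_trans (Nat.cast_le.2 (Nat.floor_le_floor
    (mul_le_mul_of_nonneg_left (le_max_right 0 _) (by positivity)))) (Nat.floor_le ?_)
  positivity

end SupervisedPageRank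

theorem mul_ops_le {M N m q p s α L R ε l : ℝ} (hα : 0 < α) (hε : 0 < ε) (hL : 0 ≤ L)
    (hm : 0 ≤ m) (hN0 : 0 ≤ N) (hq : 0 ≤ q) (hp : 0 ≤ p) (hs : 0 ≤ s)
    (hM : M ≤ 32 * m * (L * R ^ 2 / ε)) (hN : N ≤ 1 / α * l) :
    M * (2 * (q * (N * (p * s)))) ≤ 64 * m * p * s * q * (L * R ^ 2 / (α * ε)) * l := by
  calc M * (2 * (q * (N * (p * s)))) ≤
      32 * m * (L * R ^ 2 / ε) * (2 * (q * (1 / α * l * (p * s)))) := by gcongr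
    _ = _ := by field_simp; ring

namespace SupervisedPageRank

variable {V Q : Type*} [Finite V] {m₁ m₂ k : ℕ} (D : SupervisedPageRank V Q m₁ m₂ k) [Fintype Q]

theorem run_ops_le {φ₀ : ParamSpace m₁ m₂} {L R ε : ℝ} {dir : ℕ → ParamSpace m₁ m₂}
    {U : Set (ParamSpace m₁ m₂)} {s : ℕ} (hs : ∀ q, ∀ φ ∈ U, D.sparsity q φ ≤ s)
    (hU₀ : ∀ n, (D.run φ₀ L R ε dir n).val ∈ U)
    (hU₁ : ∀ n, (D.run φ₀ L R ε dir n).val + smoothing (m₁ + m₂) L ε • dir n ∈ U) (n : ℕ) :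
    (D.run φ₀ L R ε dir n).ops ≤
      n * (2 * (Fintype.card Q * (D.innerSteps L R ε * (D.p * s)))) := by
  induction n with
  | zero => simp [run]
  | succ n ih =>
    have h1 := D.approxLoss_ops_le (fun q => hs q _ (hU₀ n)) (D.innerSteps L R ε)
    have h2 := D.approxLoss_ops_le (fun q => hs q _ (hU₁ n)) (D.innerSteps L R ε)
    have h3 : (D.run φ₀ L R ε dir (n + 1)).ops = (D.run φ₀ L R ε dir n).ops +
        (D.approxLoss (D.innerSteps L R ε) ((D.run φ₀ L R ε dir n).val +
          smoothing (m₁ + m₂) L ε • dir n)).ops +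
        (D.approxLoss (D.innerSteps L R ε) (D.run φ₀ L R ε dir n).val).ops := rfl
    rw [h3, Nat.succ_mul]
    omega

end SupervisedPageRank

/-! ### Accuracy and mean cost of the two-level method -/

theorem theorem2 {V Q : Type*} [Finite V] [Fintype Q] [Nonempty Q] {m₁ m₂ k : ℕ}
    (hm : 0 < m₁ + m₂) (D : SupervisedPageRank V Q m₁ m₂ k)
    -- the weights depend measurably on the parameters
    (hFmeas : ∀ q i, Measurable fun φ₁ => D.F q φ₁ i)
    (hGmeas : ∀ q i j, D.graph.Adj i j → Measurable fun φ₂ => D.G q φ₂ i j)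
    -- the input of the method
    (φ₀ : ParamSpace m₁ m₂) {L R ε : ℝ} (hL : 0 < L) (hR : 0 < R) (hε : 0 < ε)
    -- the local minimum point, and a vicinity in which the method works
    (φs : ParamSpace m₁ m₂) (hmin : IsLocalMin D.loss φs) (hφ₀ : ‖φ₀ - φs‖ ≤ R)
    (U : Set (ParamSpace m₁ m₂)) (hUopen : IsOpen U)
    (hU : Metric.closedBall φs (3 * R + smoothing (m₁ + m₂) L ε) ⊆ U)
    (hF : ∀ φ ∈ U, ∀ q i, 0 ≤ D.F q φ.node i)
    (hG : ∀ φ ∈ U, ∀ q i j, D.graph.Adj i j → 0 ≤ D.G q φ.edge i j)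
    (hconv : ConvexOn ℝ U D.loss) (hsmooth : SmoothOn L U D.loss)
    -- the sparsity parameter
    (s : ℕ) (hs : ∀ q, ∀ φ ∈ U, D.sparsity q φ ≤ s)
    -- independent random directions, uniformly distributed over the unit sphere
    {Ω : Type*} [MeasurableSpace Ω] (P : Measure Ω) [IsProbabilityMeasure P]
    (dir : ℕ → Ω → ParamSpace m₁ m₂) (hdirmeas : ∀ n, Measurable (dir n))
    (hdirindep : iIndepFun dir P) (hdirlaw : ∀ n, P.map (dir n) = uniformSphere m₁ m₂) :
    -- the accuracy
    (∀ φhat : Ω → ParamSpace m₁ m₂,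
      (∀ ω, D.IsOutput φ₀ L R ε (fun n => dir n ω) (φhat ω)) →
        Integrable (fun ω => D.loss (φhat ω)) P ∧
        (∫ ω, D.loss (φhat ω) ∂P) - D.loss φs ≤ ε) ∧
    -- the mean number of arithmetic operations
    Integrable (fun ω =>
      ((D.run φ₀ L R ε (fun n => dir n ω) (outerSteps (m₁ + m₂) L R ε)).ops : ℝ)) P ∧
    (∫ ω,
      ((D.run φ₀ L R ε (fun n => dir n ω) (outerSteps (m₁ + m₂) L R ε)).ops : ℝ) ∂P) ≤
      64 * (m₁ + m₂ : ℕ) * D.p * s * Fintype.card Q * (L * R ^ 2 / (D.α * ε)) *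
        max 0 (Real.log (4 * (2 * D.r + D.b * √(2 * D.r)) *
          (32 * (m₁ + m₂ : ℕ) * R * √(L * ((m₁ + m₂ : ℕ) + 8)) /
            (ε ^ (3 / 2 : ℝ) * √2)))) := by
  have hμ := smoothing_pos (m₁ + m₂) hL hε
  set N := D.innerSteps L R ε with hN
  set M := outerSteps (m₁ + m₂) L R ε with hM
  set x : ℕ → Ω → ParamSpace m₁ m₂ := fun n ω => (D.run φ₀ L R ε (fun n => dir n ω) n).val with hx
  have hloss := D.measurable_loss hFmeas hGmeas
  have happrox := D.measurable_approxLoss hFmeas hGmeas N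
  have hx0 : ∀ ω, x 0 ω = φ₀ := fun _ => rfl
  have hxs : ∀ n ω, x (n + 1) ω = gradientFreeStep (fun φ => (D.approxLoss N φ).val) φ₀ L R
      (smoothing (m₁ + m₂) L ε) (x n ω) (dir n ω) := fun _ _ => rfl
  have hxm := measurable_iterate hdirmeas (measurable_gradientFreeStep happrox φ₀ L R
      (smoothing (m₁ + m₂) L ε)) hx0 hxs
  refine ⟨fun φhat hout => ?_, ?_⟩
  · exact integral_best_iterate_sub_le hm hL hR hε hφ₀ hUopen hU hmin hconv hsmooth hloss happrox
      (fun v hv => D.abs_approxLoss_sub_loss_le hm hL hR hε (hF v hv) (hG v hv))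
      hdirmeas hdirindep hdirlaw hx0 hxs
      (fun ω => let ⟨n, hn, hφ⟩ := (hout ω).1; ⟨n, hn, congrArg D.loss hφ⟩)
      (fun ω => (hout ω).2)
  have hx3 : ∀ n ω, ‖x n ω - φs‖ ≤ 3 * R := by
    intro n ω
    rw [← mem_closedBall_iff_norm]
    apply closedBall_two_mul_subset hφ₀
    cases n with
    | zero => exact Metric.mem_closedBall_self (by positivity)
    | succ n => rw [hxs]; exact gradientFreeStep_mem _ φ₀ L _ hR.le _ _
  have hunit : ∀ᵐ ω ∂P, ∀ n, ‖dir n ω‖ = 1 := by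
    refine ae_all_iff.2 fun n => ?_
    have := ae_norm_eq_one_uniformSphere (m₁ := m₁) (m₂ := m₂)
    rw [← hdirlaw n] at this
    exact ae_of_ae_map (hdirmeas n).aemeasurable this
  -- Only almost sure: the projection confines every iterate, but the shifted point `φ_n + μ s_n` is
  -- known to lie in `U`, where the sparsity bound applies, only for directions of norm `1`.
  have hops : ∀ᵐ ω ∂P, ((D.run φ₀ L R ε (fun n => dir n ω) M).ops : ℝ) ≤
      M * (2 * (Fintype.card Q * (N * (D.p * s)))) := by
    filter_upwards [hunit] with ω hω
    refine le_trans (Nat.cast_le.2 (D.run_ops_le hs (fun n => hU ?_) (fun n => hU ?_) M)) ?_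
    · rw [mem_closedBall_iff_norm]
      linarith [hx3 n ω]
    · rw [mem_closedBall_iff_norm, add_sub_right_comm]
      refine (norm_add_le _ _).trans (add_le_add (hx3 n ω) ?_)
      rw [norm_smul, hω n, mul_one, Real.norm_of_nonneg hμ.le]
    · push_cast; exact le_rfl
  have hmeas : ∀ n, Measurable fun ω => (D.run φ₀ L R ε (fun n => dir n ω) n).ops := by
    have hapx := D.measurable_approxLoss_ops hGmeas N
    intro n
    induction n with
    | zero => exact measurable_const
    | succ n ih =>
      exact (ih.add (hapx.comp ((hxm n).add ((hdirmeas n).const_smul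
        (smoothing (m₁ + m₂) L ε))))).add (hapx.comp (hxm n))
  have hint : Integrable (fun ω => ((D.run φ₀ L R ε (fun n => dir n ω) M).ops : ℝ)) P := by
    refine Integrable.of_bound (measurable_from_nat.comp (hmeas M)).aestronglyMeasurable
      (M * (2 * (Fintype.card Q * (N * (D.p * s))))) (hops.mono fun ω hω => ?_)
    rwa [Real.norm_of_nonneg (Nat.cast_nonneg _)]
  refine ⟨hint, (integral_mono_ae hint (integrable_const _) hops).trans ?_⟩
  have hNle := D.innerSteps_le L R ε
  have hMle : (M : ℝ) ≤ 32 * ((m₁ + m₂ : ℕ) : ℝ) * (L * R ^ 2 / ε) := Nat.floor_le (by positivity)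
  have hα := D.α_pos
  simp only [integral_const, probReal_univ, one_smul]
  exact mul_ops_le hα hε hL.le (Nat.cast_nonneg _) (Nat.cast_nonneg _) (Nat.cast_nonneg _)
    (Nat.cast_nonneg _) (Nat.cast_nonneg _) hMle hNle

end
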